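/- Let $K$ be an algebraically closed field of characteristic $0$ (for instance $\mathbb{C}$) and $n\ge 3$. Let $f=(a,b,c)$ be homogeneous polynomials of degree $n$ in $K[s,v]$ with $\gcd(a,b,c)=1$, such that $\phi=(a:b:c):\mathbb{P}^1\to\mathbb{P}^2$ is birational onto its image. Let $p=(p_1,p_2,p_3)$, $q=(q_1,q_2,q_3)$ be a $\mu$-basis of $\phi$, that is, a basis of the $K[s,v]$-module of syzygies of $(a,b,c)$ with $p$ homogeneous of degree $\mu$, $q$ homogeneous of degree $n-\mu$, and $\mu\le n-\mu$. Put $$p_\phi=p_1(s,v)a(t,u)+p_2(s,v)b(t,u)+p_3(s,v)c(t,u),\qquad q_\phi=q_1(s,v)a(t,u)+q_2(s,v)b(t,u)+q_3(s,v)c(t,u).$$ Let $S(t,u)$ be the $n\times n$ Sylvester matrix of $p_\phi,q_\phi$ with respect to $(s,v)$, i.e. the matrix of $(\alpha,\beta)\mapsto\alpha p_\phi+\beta q_\phi$ from $K[t,u]\otimes (K[s,v]_{n-\mu-1}\oplus K[s,v]_{\mu-1})$ to $K[t,u]\otimes K[s,v]_{n-1}$ in the monomial bases, and let $M$ be the cokernel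 of $S(t,1)$, a module over $R=K[t]$, with Fitting ideals $\mathfrak F_\ell(M)$. Then $su-tv$ divides $p_\phi$ and $q_\phi$ in $K[s,v,t,u]$; let $$\Delta(t,u)=\mathrm{Res}_{(s,v)}\Big(\frac{p_\phi}{su-tv},\frac{q_\phi}{su-tv}\Big),$$ the resultant of forms of degrees $\mu-1$ and $n-\mu-1$ in $(s,v)$. The following hold. 1. Let $\mathrm{SRes}(p,q)\in K[x_1,x_2,x_3]$ be the first principal subresultant of $\sum_i x_ip_i(s,v)$ and $\sum_i x_iq_i(s,v)$ with respect to $(s,v)$ (the coefficient of $s$ in the dehomogenized first subresultant). Then $\mathrm{SRes}(p,q)(a(t,u),b(t,u),c(t,u))=\gamma\,u^{n-2}\Delta(t,u)$ for some nonzero $\gamma\in K$; in particular $\Delta(t,1)$ is, up to a nonzero constant, $\mathrm{SRes}(p,q)(a(t,1),b(t,1),c(t,1))$. 2. $\mathfrak F_0(M)=0$ and $\mathfrak F_1(M)=(\Delta(t,1))$; moreover $M$ has rank $1$, i.e. $1$ is the smallest $r$ with $\mathfrak F_r(M)\ne 0$; and $\mathfrak F_\ell(M)=R$ for all $\ell>n-\mu$.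 3. Let $d_1,\dots,d_n\in K[t,u]$ be any collection of singular factors of $\phi$, i.e. homogeneous polynomials such that for $i=1,\dots,n$ the product $d_n^{\,n-i+1}d_{n-1}^{\,n-i}\cdots d_{i+1}^{\,2}d_i$ is a greatest common divisor of the $(n+1-i)$-minors of $S(t,u)$. Then, up to multiplication by nonzero constants of $K$, $d_k=1$ for $n-\mu<k\le n$, and $$\Delta(t,u)=d_{n-\mu}(t,u)^{n-\mu-1}\,d_{n-\mu-1}(t,u)^{n-\mu-2}\cdots d_2(t,u).$$ -/

import Mathlib

open MvPolynomial

noncomputable section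

namespace PlaneCurve

/-- The `k`-th Fitting ideal of a finitely generated module: it is generated by the minors of size
`m - k` of the matrices whose rows are linear relations among `m` generators of `M`. When `m ≤ k`
the only such minor is the empty determinant `1`. -/
def fittingIdeal (R M : Type*) [CommRing R] [AddCommGroup M] [Module R M] (k : ℕ) : Ideal R :=
  Ideal.span {x : R | ∃ (m : ℕ) (g : Fin m → M), Submodule.span R (Set.range g) = ⊤ ∧
    ∃ (A : Matrix (Fin (m - k)) (Fin m) R) (c : Fin (m - k) → Fin m),
      (∀ i, ∑ j, A i j • g j = 0) ∧ x = (A.submatrix id c).det}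

/-- `D` is a greatest common divisor of the minors of size `k` of the matrix `A`. -/
def IsGCDOfMinors {R : Type*} [CommRing R] {N : ℕ} (A : Matrix (Fin N) (Fin N) R) (k : ℕ)
    (D : R) : Prop :=
  (∀ r c : Fin k ↪ Fin N, D ∣ (A.submatrix r c).det) ∧
    ∀ E : R, (∀ r c : Fin k ↪ Fin N, E ∣ (A.submatrix r c).det) → E ∣ D

/-- Substitution of `1` for the second variable. The form `∑ cᵢ sⁱ vᵈ⁻ⁱ` of degree `d` becomes
the polynomial `∑ cᵢ Xⁱ`, so that coefficients in the monomial basis are kept. -/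
def dehom (R : Type*) [CommRing R] : MvPolynomial (Fin 2) R →ₐ[R] Polynomial R :=
  aeval ![Polynomial.X, 1]

/-- The Sylvester matrix, in the monomial bases, of two binary forms `F`, `G` of degrees `d`, `e`:
its columns are the coefficients of `sʲ vᵈ⁻¹⁻ʲ G` (`j < d`) and of `sʲ vᵉ⁻¹⁻ʲ F` (`j < e`). -/
def formSylvester {R : Type*} [CommRing R] (F G : MvPolynomial (Fin 2) R) (d e : ℕ) :
    Matrix (Fin (d + e)) (Fin (d + e)) R :=
  Polynomial.sylvester (dehom R F) (dehom R G) d e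

/-- The resultant of two binary forms of degrees `d` and `e`. -/
def formResultant {R : Type*} [CommRing R] (F G : MvPolynomial (Fin 2) R) (d e : ℕ) : R :=
  (formSylvester F G d e).det

/-- The first principal subresultant of two binary forms `F`, `G` of degrees `d`, `e`: the minor
of the Sylvester matrix whose columns are `sʲ vᵉ⁻²⁻ʲ F` (`j < e - 1`) and `sʲ vᵈ⁻²⁻ʲ G`
(`j < d - 1`), written as forms of degree `d + e - 2`, and whose rows are the coefficients of
`s^(i+1)`, for `i < d + e - 2`. -/
def formSRes {R : Type*} [CommRing R] (F G : MvPolynomial (Fin 2) R) (d e : ℕ) : R :=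
  Matrix.det (Matrix.of fun i j : Fin ((e - 1) + (d - 1)) => j.addCases
    (fun j₁ => (Polynomial.X ^ (j₁ : ℕ) * dehom R F).coeff (i + 1))
    (fun j₁ => (Polynomial.X ^ (j₁ : ℕ) * dehom R G).coeff (i + 1)))

variable {K : Type*} [Field K]

/-- The map `φ = (f₀ : f₁ : f₂)` from the projective line to the projective plane is birational
onto its image: there are forms `A`, `B` of the same degree such that the rational map `(A : B)`
is defined at the generic point of the image and `(A(f) : B(f)) = (s : v)`. -/
def IsBirationalOntoImage (f : Fin 3 → MvPolynomial (Fin 2) K) : Prop :=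
  ∃ (k : ℕ) (A B : MvPolynomial (Fin 3) K), A.IsHomogeneous k ∧ B.IsHomogeneous k ∧
    (aeval f A ≠ 0 ∨ aeval f B ≠ 0) ∧ aeval f A * X 1 = aeval f B * X 0

/-- A proper parameterization of degree `n` of a plane curve: three binary forms of degree `n`
without common factor that define a map birational onto its image. -/
structure IsProperParam (n : ℕ) (f : Fin 3 → MvPolynomial (Fin 2) K) : Prop where
  homogeneous : ∀ i, (f i).IsHomogeneous n
  gcd_eq_one : ∀ g : MvPolynomial (Fin 2) K, (∀ i, g ∣ f i) → IsUnit g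
  birational : IsBirationalOntoImage f

/-- The module of syzygies of `(f₀, f₁, f₂)`. -/
def syzygies (f : Fin 3 → MvPolynomial (Fin 2) K) :
    Submodule (MvPolynomial (Fin 2) K) (Fin 3 → MvPolynomial (Fin 2) K) :=
  LinearMap.ker (Fintype.linearCombination (MvPolynomial (Fin 2) K) f)

/-- `p`, `q` is a `μ`-basis of `f`: a basis of the module of syzygies consisting of homogeneous
elements of degrees `μ ≤ n - μ`. -/
structure IsMuBasis (n μ : ℕ) (f p q : Fin 3 → MvPolynomial (Fin 2) K) : Prop where
  two_mul_le : 2 * μ ≤ n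
  homogeneous_left : ∀ i, (p i).IsHomogeneous μ
  homogeneous_right : ∀ i, (q i).IsHomogeneous (n - μ)
  linearIndependent : LinearIndependent (MvPolynomial (Fin 2) K) ![p, q]
  span_eq : Submodule.span (MvPolynomial (Fin 2) K) {p, q} = syzygies f

/-- The form `p₀(s,v) y₀ + p₁(s,v) y₁ + p₂(s,v) y₂` in `(s,v)`, with coefficients in `R`. -/
def linForm {R : Type*} [CommRing R] [Algebra K R] (p : Fin 3 → MvPolynomial (Fin 2) K)
    (y : Fin 3 → R) : MvPolynomial (Fin 2) R :=
  ∑ i, C (y i) * map (algebraMap K R) (p i)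

/-- `p_φ(s,v;t,u) = ∑ pᵢ(s,v) fᵢ(t,u)`, as a form in `(s,v)` with coefficients in `K[t,u]`. -/
def phiForm (f p : Fin 3 → MvPolynomial (Fin 2) K) :
    MvPolynomial (Fin 2) (MvPolynomial (Fin 2) K) :=
  linForm p f

/-- The form `s u - t v`, where `(s,v)` are the outer variables and `(t,u)` the inner ones. -/
def diag (K : Type*) [Field K] : MvPolynomial (Fin 2) (MvPolynomial (Fin 2) K) :=
  X 0 * C (X 1) - C (X 0) * X 1

open Classical in
/-- The quotient of `F` by `s u - t v` if it divides `F` (and `0` otherwise). -/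
def divDiag (F : MvPolynomial (Fin 2) (MvPolynomial (Fin 2) K)) :
    MvPolynomial (Fin 2) (MvPolynomial (Fin 2) K) :=
  if h : diag K ∣ F then h.choose else 0

/-- The Sylvester matrix of `p_φ` and `q_φ` over `K[t,u]`, of size `n = μ + (n - μ)`. -/
def sylvesterPhi (n μ : ℕ) (f p q : Fin 3 → MvPolynomial (Fin 2) K) :
    Matrix (Fin (μ + (n - μ))) (Fin (μ + (n - μ))) (MvPolynomial (Fin 2) K) :=
  formSylvester (phiForm f p) (phiForm f q) μ (n - μ)

/-- The cokernel of the Sylvester matrix specialized at `(t,1)`, a module over `K[t]`. -/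
abbrev sylvesterCoker (n μ : ℕ) (f p q : Fin 3 → MvPolynomial (Fin 2) K) : Type _ :=
  (Fin (μ + (n - μ)) → Polynomial K) ⧸
    LinearMap.range (((sylvesterPhi n μ f p q).map (dehom K)).mulVecLin)

/-- `Δ(t,u) = Res_{(s,v)} (p_φ / (su - tv), q_φ / (su - tv))`; the two quotients are forms of
degrees `μ - 1` and `n - μ - 1` in `(s,v)`. -/
def Delta (n μ : ℕ) (f p q : Fin 3 → MvPolynomial (Fin 2) K) : MvPolynomial (Fin 2) K :=
  formResultant (divDiag (phiForm f p)) (divDiag (phiForm f q)) (μ - 1) (n - μ - 1)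

/-- The first principal subresultant, in `K[x₀, x₁, x₂]`, of `∑ xᵢ pᵢ(s,v)` and `∑ xᵢ qᵢ(s,v)`
with respect to `(s,v)`. -/
def SRes (n μ : ℕ) (p q : Fin 3 → MvPolynomial (Fin 2) K) : MvPolynomial (Fin 3) K :=
  formSRes (linForm p (X : Fin 3 → MvPolynomial (Fin 3) K)) (linForm q X) μ (n - μ)

/-- `d 1, …, d n` is a collection of singular factors: homogeneous polynomials in `K[t,u]` such
that, for `1 ≤ i ≤ n`, the product `d_n ^ (n-i+1) ⋯ d_{i+1} ^ 2 d_i` is a greatest common divisor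
of the minors of size `n + 1 - i` of the Sylvester matrix. -/
structure IsSingularFactors (n μ : ℕ) (f p q : Fin 3 → MvPolynomial (Fin 2) K)
    (d : ℕ → MvPolynomial (Fin 2) K) : Prop where
  homogeneous : ∀ i ∈ Finset.Icc 1 n, ∃ e : ℕ, (d i).IsHomogeneous e
  isGCD : ∀ i ∈ Finset.Icc 1 n, IsGCDOfMinors (sylvesterPhi n μ f p q) (n + 1 - i)
    (∏ k ∈ Finset.Icc i n, d k ^ (k + 1 - i))

end PlaneCurve

end

/-! Write `p_φ = L P` and `q_φ = L Q` with `L = su - tv`. The Sylvester matrix `S` of `L P, L Q` is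
then the `n × (n-1)` matrix of multiplication by `L` times the `(n-1) × n` matrix whose columns are
the shifts of `Q` and `P` (`sylvester_linPoly_mul`). Hence `det S = 0`. The second factor kills the
coefficient vector of `(-P, Q)`, so its maximal minors are, up to sign, `Res(P, Q) = Δ` times the
coefficients of `P` and `Q` (`det_coeffMatrix_submatrix`), and `Δ` divides every submaximal minor of
`S`.

Conversely, the first factor has `u^(n-1)` and `(-t)^(n-1)` among its maximal minors, so the ideal
of submaximal minors contains these powers times `Δ` times each coefficient of `p_φ` and `q_φ`. The
coefficient vectors of `p` and `q` span `K³` (`IsMuBasis.span_coeff_eq_top`), so it contains them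
times `Δ f_i` (`IsMuBasis.minorIdeal_sylvesterPhi`). Coprimality of the `f_i`, and of `u` and `t`,
makes `Δ` the gcd; at `u = 1` the `f_i` generate the unit ideal, so `Δ(t,1)` generates the whole
ideal. Fitting's lemma (`fittingIdeal_coker`) translates this to `M`.

The minors of size `μ` are coprime because, modulo any prime element or maximal ideal, some `f_i`
survives, so one of `p_φ, q_φ` does too, and `μ` shifts of it are independent. The subresultant
formula comes from the same factorization with a row deleted.

Finally `Δ ≠ 0`: take `τ` transcendental over `K`. At `(t,u) = (τ,1)`, a common root `x` of `P, Q`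
gives `f(x)` proportional to `f(τ)` by Hilbert-Burch, and birationality forces `x = τ`. Then `τ` is
a double root of `p_φ` and `q_φ`, so `f'` is proportional to `f`, which is impossible in
characteristic `0`. -/

namespace PlaneCurve

/-! ### Ideals of minors. -/

section Minors

variable {R : Type*} [CommRing R] {ι κ ν : Type*}

/-- The ideal generated by the minors of size `k` of `A`. -/
def minorIdeal (A : Matrix ι κ R) (k : ℕ) : Ideal R :=
  Ideal.span {x | ∃ (r : Fin k → ι) (c : Fin k → κ), x = (A.submatrix r c).det}

theorem det_submatrix_mem_minorIdeal (A : Matrix ι κ R) {k : ℕ} (r : Fin k → ι) (c : Fin k → κ) :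
    (A.submatrix r c).det ∈ minorIdeal A k :=
  Ideal.subset_span ⟨r, c, rfl⟩

theorem det_submatrix_mem_minorIdeal_of_card {α : Type*} [Fintype α] [DecidableEq α]
    (A : Matrix ι κ R) {k : ℕ} (hk : Fintype.card α = k) (r : α → ι) (c : α → κ) :
    (A.submatrix r c).det ∈ minorIdeal A k := by
  subst hk
  rw [← Matrix.det_submatrix_equiv_self (Fintype.equivFin α).symm]
  exact det_submatrix_mem_minorIdeal A (r ∘ _) (c ∘ _)

theorem minorIdeal_le_iff (A : Matrix ι κ R) (k : ℕ) (I : Ideal R) :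
    minorIdeal A k ≤ I ↔ ∀ (r : Fin k → ι) (c : Fin k → κ), (A.submatrix r c).det ∈ I := by
  rw [minorIdeal, Ideal.span_le]
  constructor
  · exact fun h r c => h ⟨r, c, rfl⟩
  · rintro h _ ⟨r, c, rfl⟩
    exact h r c

theorem minorIdeal_transpose (A : Matrix ι κ R) (k : ℕ) :
    minorIdeal A.transpose k = minorIdeal A k := by
  apply le_antisymm <;> rw [minorIdeal_le_iff] <;> intro r c
  · rw [← Matrix.det_transpose]
    exact det_submatrix_mem_minorIdeal A c r
  · rw [← Matrix.det_transpose]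
    exact det_submatrix_mem_minorIdeal A.transpose c r

theorem minorIdeal_succ_le (A : Matrix ι κ R) (k : ℕ) :
    minorIdeal A (k + 1) ≤ minorIdeal A k := by
  rw [minorIdeal_le_iff]
  intro r c
  rw [Matrix.det_succ_row_zero]
  refine Ideal.sum_mem _ fun j _ => Ideal.mul_mem_left _ _ ?_
  rw [Matrix.submatrix_submatrix]
  exact det_submatrix_mem_minorIdeal A _ _

theorem minorIdeal_antitone (A : Matrix ι κ R) : Antitone (minorIdeal A) :=
  antitone_nat_of_succ_le (minorIdeal_succ_le A)

/-- Multilinearity of the determinant in the rows expands a minor of `W * B` into minors of `B` with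
possibly repeated rows, which is why arbitrary index maps are convenient in `minorIdeal`. -/
theorem minorIdeal_mul_le_right [Fintype κ] (W : Matrix ι κ R) (B : Matrix κ ν R) (k : ℕ) :
    minorIdeal (W * B) k ≤ minorIdeal B k := by
  classical
  rw [minorIdeal_le_iff]
  intro r c
  have h : (W * B).submatrix r c = fun i => ∑ j, W (r i) j • (fun l => B j (c l)) := by
    ext i l
    simp [Matrix.mul_apply, Finset.sum_apply]
  have h2 : ((W * B).submatrix r c).det = Matrix.detRowAlternating.toMultilinearMap
      (fun i => ∑ j, W (r i) j • (fun l => B j (c l))) := by rw [h]; rfl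
  rw [h2, MultilinearMap.map_sum]
  refine Ideal.sum_mem _ fun s _ => ?_
  rw [MultilinearMap.map_smul_univ]
  exact Ideal.mul_mem_left _ _ (det_submatrix_mem_minorIdeal B s c)

theorem minorIdeal_mul_le_left [Fintype κ] (B : Matrix ι κ R) (V : Matrix κ ν R) (k : ℕ) :
    minorIdeal (B * V) k ≤ minorIdeal B k := by
  rw [← minorIdeal_transpose, Matrix.transpose_mul, ← minorIdeal_transpose B]
  exact minorIdeal_mul_le_right _ _ _

/-- Deleting `m` columns from a minor lowers its size by at most `m`. -/
theorem minorIdeal_fromCols_le {m : ℕ} (A : Matrix ι κ R) (B : Matrix ι (Fin m) R) (k : ℕ) :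
    minorIdeal (Matrix.fromCols A B) k ≤ minorIdeal A (k - m) := by
  suffices H : ∀ (l : ℕ), l ≤ m → ∀ (k : ℕ) (r : Fin k → ι) (c : Fin k → κ ⊕ Fin m),
      (∀ i j, c i = Sum.inr j → (j : ℕ) < l) →
      ((Matrix.fromCols A B).submatrix r c).det ∈ minorIdeal A (k - l) by
    rw [minorIdeal_le_iff]
    exact fun r c => H m le_rfl k r c fun i j _ => j.2
  intro l
  induction l with
  | zero =>
    intro _ k r c hc
    have hc' : ∀ i, ∃ j, c i = Sum.inl j := fun i => by
      rcases h : c i with j | j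
      · exact ⟨j, rfl⟩
      · exact absurd (hc i j h) (Nat.not_lt_zero _)
    choose c' hc' using hc'
    have : (Matrix.fromCols A B).submatrix r c = A.submatrix r c' := by
      ext i j
      simp [hc']
    rw [this]
    exact det_submatrix_mem_minorIdeal A r c'
  | succ l ih =>
    intro hl k r c hc
    -- Only columns of `B` with index below `l + 1` occur. If column `l` occurs, expand along it;
    -- injectivity of `c` ensures that it does not remain among the other columns.
    by_cases hx : ∃ i, c i = Sum.inr ⟨l, hl⟩
    · obtain ⟨i, hi⟩ := hx
      obtain _ | k := k
      · exact i.elim0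
      by_cases hinj : Function.Injective c
      · rw [Matrix.det_succ_column _ i]
        refine Ideal.sum_mem _ fun i' _ => Ideal.mul_mem_left _ _ ?_
        rw [Matrix.submatrix_submatrix, show k + 1 - (l + 1) = k - l by omega]
        refine ih (by omega) k _ _ fun i₁ j h => ?_
        refine lt_of_le_of_ne (Nat.lt_succ_iff.1 (hc _ j h)) fun hj => ?_
        have : c (i.succAbove i₁) = c i := by
          rw [hi, ← Function.comp_apply (f := c), h]
          exact congrArg Sum.inr (Fin.ext hj)
        exact Fin.succAbove_ne i i₁ (hinj this)
      · simp only [Function.Injective, not_forall] at hinj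
        obtain ⟨x, y, hxy, hne⟩ := hinj
        rw [Matrix.det_zero_of_column_eq hne]
        · exact Ideal.zero_mem _
        · intro i'
          simp [Matrix.submatrix_apply, hxy]
    · refine minorIdeal_antitone A (by omega : k - (l + 1) ≤ k - l)
        (ih (by omega) k r c fun i j h => ?_)
      refine lt_of_le_of_ne (Nat.lt_succ_iff.1 (hc i j h)) fun hj => hx ⟨i, ?_⟩
      rw [h]
      exact congrArg Sum.inr (Fin.ext hj)

theorem minorIdeal_map {R' : Type*} [CommRing R'] (A : Matrix ι κ R) (φ : R →+* R') (k : ℕ) :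
    minorIdeal (A.map φ) k = (minorIdeal A k).map φ := by
  apply le_antisymm
  · rw [minorIdeal_le_iff]
    intro r c
    have h := φ.map_det (A.submatrix r c)
    have h2 : φ.mapMatrix (A.submatrix r c) = (A.map φ).submatrix r c := rfl
    rw [← h2, ← h]
    exact Ideal.mem_map_of_mem _ (det_submatrix_mem_minorIdeal A r c)
  · rw [minorIdeal, Ideal.map_span, Ideal.span_le]
    rintro _ ⟨_, ⟨r, c, rfl⟩, rfl⟩
    rw [RingHom.map_det]
    exact det_submatrix_mem_minorIdeal (A.map φ) r c

end Minors

/-! ### Fitting ideals of a cokernel. -/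

section Fitting

variable {R : Type*} [CommRing R]

/-- Fitting's lemma: the Fitting ideals of a cokernel are the ideals of minors of the matrix. -/
theorem fittingIdeal_coker {N N' : ℕ} (S : Matrix (Fin N) (Fin N') R) (k : ℕ) :
    fittingIdeal R ((Fin N → R) ⧸ LinearMap.range S.mulVecLin) k = minorIdeal S (N - k) := by
  set U := LinearMap.range S.mulVecLin with hU
  apply le_antisymm
  · rw [fittingIdeal, Ideal.span_le]
    rintro _ ⟨m, g, hg, A, c, hA, rfl⟩
    choose Q hQ using fun j => Submodule.Quotient.mk_surjective U (g j)
    have hP : ∀ x : (Fin N → R) ⧸ U, ∃ y : Fin m → R, ∑ j, y j • g j = x := fun x =>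
      (Submodule.mem_span_range_iff_exists_fun R).1 (hg ▸ Submodule.mem_top)
    choose P hP using fun i : Fin N => hP (Submodule.Quotient.mk (Pi.single i 1))
    have mem_U : ∀ x : Fin N → R, (Submodule.Quotient.mk x : (Fin N → R) ⧸ U) = 0 →
        ∃ w, S.mulVec w = x := fun x hx => by
      obtain ⟨w, hw⟩ := (Submodule.Quotient.mk_eq_zero U).1 hx
      exact ⟨w, hw⟩
    have mk_sum : ∀ y : Fin m → R, (Submodule.Quotient.mk (∑ j, y j • Q j) : (Fin N → R) ⧸ U) =
        ∑ j, y j • g j := fun y => by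
      simp only [← hQ]
      exact (map_sum U.mkQ (fun j => y j • Q j) Finset.univ).trans
        (Finset.sum_congr rfl fun j _ => map_smul U.mkQ _ _)
    choose W₁ hW₁ using fun i : Fin N => mem_U (Pi.single i 1 - ∑ j, P i j • Q j) (by
      rw [Submodule.Quotient.mk_sub, mk_sum, hP, sub_self])
    choose W₂ hW₂ using fun i => mem_U (∑ j, A i j • Q j) (by rw [mk_sum, hA])
    -- `P` writes the standard generators through the `g j`, and `Q` lifts the `g j` to vectors. The
    -- block matrix `[[1, -P], [0, A]]` carries the minor of `A`; up to a unipotent column operation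
    -- by `Q`, its first `N` columns are relations of the cokernel, so they factor through the
    -- transpose of `S`. Discarding the other `m` columns compares the two ideals of minors.
    have key : Matrix.fromCols (Matrix.fromRows (1 : Matrix (Fin N) (Fin N) R) 0)
        (Matrix.fromRows (-Matrix.of P) A) =
        (Matrix.fromCols (Matrix.fromRows (Matrix.of W₁) (Matrix.of W₂) * S.transpose)
          (Matrix.fromRows (-Matrix.of P) A) : Matrix (Fin N ⊕ Fin (m - k)) (Fin N ⊕ Fin m) R) *
          (Matrix.fromBlocks 1 0 (-Matrix.of Q) 1 : Matrix (Fin N ⊕ Fin m) (Fin N ⊕ Fin m) R) := by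
      rw [Matrix.fromCols_mul_fromBlocks]
      simp only [Matrix.mul_one, Matrix.mul_zero, zero_add]
      congr 1
      ext i j
      rcases i with i | i
      · have h := congrFun (hW₁ i) j
        simp only [Matrix.mulVec, dotProduct, Pi.sub_apply, Finset.sum_apply, Pi.smul_apply,
          smul_eq_mul] at h
        simp only [Matrix.fromRows_apply_inl, Matrix.add_apply, Matrix.mul_apply,
          Matrix.of_apply, Matrix.transpose_apply, Matrix.neg_apply, neg_mul_neg, mul_comm (W₁ i _),
          h, Matrix.one_apply, Pi.single_apply, eq_comm (a := i)]
        ring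
      · have h := congrFun (hW₂ i) j
        simp only [Matrix.mulVec, dotProduct, Finset.sum_apply, Pi.smul_apply,
          smul_eq_mul] at h
        simp only [Matrix.fromRows_apply_inr, Matrix.add_apply, Matrix.mul_apply,
          Matrix.of_apply, Matrix.transpose_apply, Matrix.neg_apply, mul_comm (W₂ i _),
          h, Matrix.zero_apply, mul_neg, Finset.sum_neg_distrib, add_neg_cancel]
    have hdet : (A.submatrix id c).det = ((Matrix.fromCols
        (Matrix.fromRows (1 : Matrix (Fin N) (Fin N) R) 0)
        (Matrix.fromRows (-Matrix.of P) A)).submatrix id (Sum.map id c)).det := by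
      have : (Matrix.fromCols (Matrix.fromRows (1 : Matrix (Fin N) (Fin N) R) 0)
          (Matrix.fromRows (-Matrix.of P) A)).submatrix id (Sum.map id c) =
          Matrix.fromBlocks 1 ((-Matrix.of P).submatrix id c) 0 (A.submatrix id c) := by
        ext (i | i) (j | j) <;> simp
      rw [this, Matrix.det_fromBlocks_zero₂₁, Matrix.det_one, one_mul]
    rw [SetLike.mem_coe, hdet]
    have h1 := det_submatrix_mem_minorIdeal_of_card (k := N + (m - k)) (Matrix.fromCols
        (Matrix.fromRows (1 : Matrix (Fin N) (Fin N) R) 0)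
        (Matrix.fromRows (-Matrix.of P) A)) (by simp) id (Sum.map id c)
    rw [key] at h1 ⊢
    have h2 := minorIdeal_fromCols_le _ _ _ (minorIdeal_mul_le_left _ _ _ h1)
    have h3 := minorIdeal_mul_le_right _ _ _ h2
    rw [minorIdeal_transpose] at h3
    exact minorIdeal_antitone S (by omega) h3
  · rw [minorIdeal_le_iff]
    intro r c
    have hmk : ∀ x : Fin N → R, ∑ j, x j • (Submodule.Quotient.mk (Pi.single j 1) :
        (Fin N → R) ⧸ U) = Submodule.Quotient.mk x := fun x => by
      have h := map_sum U.mkQ (fun j => x j • (Pi.single j 1 : Fin N → R)) Finset.univ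
      simp only [map_smul, Submodule.mkQ_apply] at h
      rw [← h]
      congr 1
      ext i
      simp [Finset.sum_apply, Pi.single_apply]
    refine Ideal.subset_span ⟨N, fun j => Submodule.Quotient.mk (Pi.single j 1), ?_,
      Matrix.of fun i j => S j (c i), r, fun i => ?_, ?_⟩
    · rw [eq_top_iff]
      rintro x -
      obtain ⟨x, rfl⟩ := Submodule.Quotient.mk_surjective U x
      exact (Submodule.mem_span_range_iff_exists_fun R).2 ⟨x, hmk x⟩
    · simp only [Matrix.of_apply]
      rw [hmk fun j => S j (c i), Submodule.Quotient.mk_eq_zero]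
      refine ⟨Pi.single (c i) 1, ?_⟩
      ext j
      simp
    · rw [← Matrix.det_transpose]
      rfl

end Fitting

/-! ### Sylvester matrices and the minors of their shifts. -/

section Sylvester

open Polynomial (natDegree)

variable {R : Type*} [CommRing R]

/-- The matrix whose columns are the coefficients of degree less than `N` of the polynomials
`w j`. -/
def coeffMatrix (N : ℕ) {κ : Type*} (w : κ → Polynomial R) : Matrix (Fin N) κ R :=
  Matrix.of fun i j => (w j).coeff i

/-- The polynomials whose coefficients are the columns of the Sylvester matrix. -/
noncomputable def sylvesterCols (f g : Polynomial R) (m n : ℕ) : Fin (m + n) → Polynomial R :=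
  fun j => j.addCases (fun j => Polynomial.X ^ (j : ℕ) * g) (fun j => Polynomial.X ^ (j : ℕ) * f)

theorem sylvester_eq_coeffMatrix {f g : Polynomial R} {m n : ℕ} (hf : f.natDegree ≤ m)
    (hg : g.natDegree ≤ n) :
    Polynomial.sylvester f g m n = coeffMatrix (m + n) (sylvesterCols f g m n) := by
  ext i j
  induction j using Fin.addCases with
  | left j =>
    simp only [Polynomial.sylvester, coeffMatrix, sylvesterCols, Matrix.of_apply,
      Fin.addCases_left, Polynomial.coeff_X_pow_mul', Set.mem_Icc]
    split_ifs with h1 h2 h2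
    · rfl
    · omega
    · exact (Polynomial.coeff_eq_zero_of_natDegree_lt (by omega)).symm
    · rfl
  | right j =>
    simp only [Polynomial.sylvester, coeffMatrix, sylvesterCols, Matrix.of_apply,
      Fin.addCases_right, Polynomial.coeff_X_pow_mul', Set.mem_Icc]
    split_ifs with h1 h2 h2
    · rfl
    · omega
    · exact (Polynomial.coeff_eq_zero_of_natDegree_lt (by omega)).symm
    · rfl

theorem coeffMatrix_mul {κ : Type*} (L : Polynomial R) (M N : ℕ) (w : κ → Polynomial R)
    (hw : ∀ j, (w j).natDegree < N) :
    coeffMatrix M (fun j => L * w j) =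
      coeffMatrix M (fun k : Fin N => L * Polynomial.X ^ (k : ℕ)) * coeffMatrix N w := by
  ext i j
  simp only [coeffMatrix, Matrix.of_apply, Matrix.mul_apply]
  conv_lhs => rw [(w j).as_sum_range' N (hw j)]
  rw [Finset.mul_sum, Polynomial.finsetSum_coeff, Finset.sum_range]
  refine Finset.sum_congr rfl fun k _ => ?_
  rw [← Polynomial.C_mul_X_pow_eq_monomial, mul_left_comm, Polynomial.coeff_C_mul, mul_comm]

theorem sylvesterCols_mul (L f g : Polynomial R) (m n : ℕ) (j : Fin (m + n)) :
    sylvesterCols (L * f) (L * g) m n j = L * sylvesterCols f g m n j := by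
  induction j using Fin.addCases <;> simp [sylvesterCols, mul_left_comm]

theorem natDegree_sylvesterCols_lt {f g : Polynomial R} {a b m n N : ℕ} (hf : f.natDegree ≤ a)
    (hg : g.natDegree ≤ b) (hm : m + b ≤ N) (hn : n + a ≤ N) (j : Fin (m + n)) :
    (sylvesterCols f g m n j).natDegree < N := by
  induction j using Fin.addCases with
  | left j =>
    simp only [sylvesterCols, Fin.addCases_left]
    have := Polynomial.natDegree_mul_le (p := Polynomial.X ^ (j : ℕ)) (q := g)
    have := Polynomial.natDegree_X_pow_le (R := R) (j : ℕ)
    omega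
  | right j =>
    simp only [sylvesterCols, Fin.addCases_right]
    have := Polynomial.natDegree_mul_le (p := Polynomial.X ^ (j : ℕ)) (q := f)
    have := Polynomial.natDegree_X_pow_le (R := R) (j : ℕ)
    omega

/-- The maximal minors of a matrix with one more column than rows are proportional to any vector
in its kernel. -/
theorem det_submatrix_succAbove_mul {N : ℕ} (A : Matrix (Fin N) (Fin (N + 1)) R)
    (k : Fin (N + 1) → R) (hk : A.mulVec k = 0) (i j : Fin (N + 1)) :
    (-1) ^ (i : ℕ) * (A.submatrix id i.succAbove).det * k j =
      (-1) ^ (j : ℕ) * (A.submatrix id j.succAbove).det * k i := by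
  -- With the unit row `i` on top, `B` has determinant plus or minus the `i`-th minor and sends `k`
  -- to `k i` times the first basis vector. Applying the adjugate gives the proportionality.
  let B : Matrix (Fin (N + 1)) (Fin (N + 1)) R := Matrix.of (Fin.cons (Pi.single i 1) A)
  have hB : ∀ j : Fin (N + 1), B.submatrix Fin.succ j.succAbove = A.submatrix id j.succAbove :=
    fun j => rfl
  have hB₀ : ∀ y, B 0 y = (Pi.single i 1 : Fin (N + 1) → R) y := fun y => rfl
  have hdet : B.det = (-1) ^ (i : ℕ) * (A.submatrix id i.succAbove).det := by
    rw [Matrix.det_succ_row_zero, Finset.sum_eq_single i]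
    · rw [hB, hB₀, Pi.single_eq_same, mul_one]
    · intro x _ hx
      rw [hB₀, Pi.single_eq_of_ne hx, mul_zero, zero_mul]
    · simp
  have hBk : B.mulVec k = Pi.single 0 (k i) := by
    ext x
    refine Fin.cases ?_ (fun x => ?_) x
    · simp [Matrix.mulVec, dotProduct, hB₀, Pi.single_apply]
    · rw [Pi.single_eq_of_ne (Fin.succ_ne_zero x)]
      exact congrFun hk x
  have h := congrFun (congrArg (B.adjugate.mulVec) hBk) j
  rw [Matrix.mulVec_mulVec, Matrix.adjugate_mul, Matrix.smul_mulVec, Matrix.one_mulVec,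
    Matrix.mulVec_single, Matrix.col, Matrix.adjugate] at h
  rw [← hdet]
  simp only [Pi.smul_apply, smul_eq_mul] at h
  rw [h, ← hB]
  have h2 := Matrix.adjugate_fin_succ_eq_det_submatrix B j 0
  rw [Matrix.adjugate] at h2
  simp only [Matrix.transpose_apply, MulOpposite.smul_eq_mul_unop, MulOpposite.unop_op] at h2 ⊢
  rw [h2]
  simp

/-- The relation `-f * g + g * f = 0`, as a vector of coefficients. -/
def sylvesterKernel (f g : Polynomial R) (a b : ℕ) : Fin (a + 1 + (b + 1)) → R :=
  fun j => j.addCases (fun j => -f.coeff j) (fun j => g.coeff j)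

theorem coeffMatrix_mulVec_sylvesterKernel {f g : Polynomial R} {a b : ℕ} (hf : f.natDegree ≤ a)
    (hg : g.natDegree ≤ b) (N : ℕ) :
    (coeffMatrix N (sylvesterCols f g (a + 1) (b + 1))).mulVec (sylvesterKernel f g a b) = 0 := by
  have hsum : ∀ (p : Polynomial R) (d : ℕ), p.natDegree ≤ d →
      ∑ j : Fin (d + 1), Polynomial.C (p.coeff j) * Polynomial.X ^ (j : ℕ) = p := fun p d h => by
    conv_rhs => rw [p.as_sum_range_C_mul_X_pow' (Nat.lt_succ_of_le h)]
    rw [Finset.sum_range]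
  have h0 : ∑ j, Polynomial.C (sylvesterKernel f g a b j) *
      sylvesterCols f g (a + 1) (b + 1) j = 0 := by
    rw [Fin.sum_univ_add]
    simp only [sylvesterKernel, sylvesterCols, Fin.addCases_left, Fin.addCases_right, ← mul_assoc,
      ← Finset.sum_mul, Polynomial.C_neg, neg_mul, Finset.sum_neg_distrib, hsum f a hf,
      hsum g b hg]
    ring
  ext i
  have h := congrArg (fun p => Polynomial.coeff p i) h0
  simp only [Polynomial.finsetSum_coeff, Polynomial.coeff_C_mul, Polynomial.coeff_zero] at h
  simpa [Matrix.mulVec, dotProduct, coeffMatrix, mul_comm] using h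

/-- Minor `j` is compared with the last one, where the kernel vector has entry `g.coeff b`. This
leaves a factor `g.coeff b` on both sides, which may be a zero divisor here and is cancelled
generically afterwards. -/
theorem coeff_mul_det_coeffMatrix_submatrix {f g : Polynomial R} {a b : ℕ}
    (hf : f.natDegree ≤ a) (hg : g.natDegree ≤ b) (j : Fin (a + 1 + (b + 1))) :
    g.coeff b * ((-1) ^ (j : ℕ) * ((coeffMatrix (a + 1 + b)
      (sylvesterCols f g (a + 1) (b + 1))).submatrix id (Fin.succAbove (n := a + 1 + b) j)).det) =
    g.coeff b * ((-1) ^ (a + 1) * Polynomial.resultant f g a b * sylvesterKernel f g a b j) := by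
  have h := det_submatrix_succAbove_mul (N := a + 1 + b) _ _
    (coeffMatrix_mulVec_sylvesterKernel hf hg _) (Fin.last (a + 1 + b)) j
  have h1 : sylvesterKernel f g a b (Fin.last (a + 1 + b)) = g.coeff b := by
    have : (Fin.last (a + 1 + b) : Fin (a + 1 + (b + 1))) = Fin.natAdd (a + 1) (Fin.last b) := by
      ext; simp
    rw [this, sylvesterKernel, Fin.addCases_right, Fin.val_last]
  -- Deleting the last shift of `f` leaves a Sylvester matrix in which `f` has formal degree `a +
  -- 1`. The excess degree contributes a sign and a second factor `g.coeff b`.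
  have h2 : (coeffMatrix (a + 1 + b) (sylvesterCols f g (a + 1) (b + 1))).submatrix id
      (Fin.last (a + 1 + b)).succAbove = Polynomial.sylvester f g (a + 1) b := by
    rw [sylvester_eq_coeffMatrix (hf.trans (Nat.le_succ a)) hg]
    ext i j
    induction j using Fin.addCases with
    | left j =>
      have : (Fin.castSucc (Fin.castAdd b j) : Fin (a + 1 + b + 1)) = Fin.castAdd (b + 1) j := by
        ext; simp
      simp only [coeffMatrix, Matrix.submatrix_apply, Matrix.of_apply, Fin.succAbove_last,
        this, sylvesterCols, Fin.addCases_left, id]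
    | right j =>
      have : (Fin.castSucc (Fin.natAdd (a + 1) j) : Fin (a + 1 + b + 1)) =
          Fin.natAdd (a + 1) j.castSucc := by
        ext; simp
      simp only [coeffMatrix, Matrix.submatrix_apply, Matrix.of_apply, Fin.succAbove_last,
        this, sylvesterCols, Fin.addCases_right, id, Fin.val_castSucc]
  have h3 : ((-1 : R) ^ b) * (-1) ^ b = 1 := by rw [← mul_pow]; simp
  have h4 := Polynomial.resultant_succ_left_deg f g a b hf
  rw [Polynomial.resultant] at h4
  rw [h1, h2, h4, Fin.val_last, pow_add] at h
  linear_combination -h + g.coeff b * (-1) ^ (a + 1) * Polynomial.resultant f g a b *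
    sylvesterKernel f g a b j * h3

theorem det_coeffMatrix_submatrix {f g : Polynomial R} {a b : ℕ}
    (hf : f.natDegree ≤ a) (hg : g.natDegree ≤ b) (j : Fin (a + 1 + (b + 1))) :
    (-1) ^ (j : ℕ) * ((coeffMatrix (a + 1 + b)
      (sylvesterCols f g (a + 1) (b + 1))).submatrix id (Fin.succAbove (n := a + 1 + b) j)).det =
    (-1) ^ (a + 1) * Polynomial.resultant f g a b * sylvesterKernel f g a b j := by
  -- Adding an indeterminate to the top coefficient of `g` makes that coefficient monic, hence
  -- cancellable; evaluating the indeterminate at `0` then recovers `f` and `g`.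
  let F : Polynomial (Polynomial R) := f.map Polynomial.C
  let G : Polynomial (Polynomial R) := g.map Polynomial.C +
    Polynomial.C Polynomial.X * Polynomial.X ^ b
  have hF : F.natDegree ≤ a := Polynomial.natDegree_map_le.trans hf
  have hG : G.natDegree ≤ b := by
    refine Polynomial.natDegree_add_le_of_degree_le (Polynomial.natDegree_map_le.trans hg) ?_
    exact Polynomial.natDegree_C_mul_X_pow_le _ _
  have hGb : G.coeff b = Polynomial.X + Polynomial.C (g.coeff b) := by
    simp [G, add_comm]
  have h := coeff_mul_det_coeffMatrix_submatrix hF hG j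
  rw [hGb] at h
  have h := (Polynomial.monic_X_add_C (g.coeff b)).isRegular.left h
  let φ : Polynomial R →+* R := Polynomial.evalRingHom 0
  have hφ : φ.comp Polynomial.C = RingHom.id R := by ext; simp [φ]
  have hF' : F.map φ = f := by rw [Polynomial.map_map, hφ, Polynomial.map_id]
  have hG' : G.map φ = g := by
    rw [Polynomial.map_add, Polynomial.map_map, hφ, Polynomial.map_id]
    simp [φ]
  have h := congrArg φ h
  rw [map_mul, map_mul, map_mul, map_pow, map_pow, map_neg, map_one, RingHom.map_det,
    ← Polynomial.resultant_map_map, hF', hG'] at h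
  convert h using 3
  · ext x y
    have hc : ∀ z, (sylvesterCols F G (a + 1) (b + 1) z).map φ =
        sylvesterCols f g (a + 1) (b + 1) z := fun z => by
      induction z using Fin.addCases <;> simp [sylvesterCols, hF', hG']
    simp [coeffMatrix, ← hc]
  · rw [← hF', ← hG']
    induction j using Fin.addCases <;> simp [sylvesterKernel]

end Sylvester

/-! ### Sylvester matrices of polynomials with a common linear factor. -/

section Linear

variable {R : Type*} [CommRing R]

theorem det_dvd_det_submatrix {N : ℕ} (B : Matrix (Fin N) (Fin N) R) (r c : Fin N → Fin N) :
    B.det ∣ (B.submatrix r c).det := by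
  have : B.submatrix r c = (1 : Matrix (Fin N) (Fin N) R).submatrix r id * B *
      (1 : Matrix (Fin N) (Fin N) R).submatrix id c := by
    ext i j
    simp [Matrix.mul_apply, Matrix.one_apply]
  rw [this, Matrix.det_mul, Matrix.det_mul]
  exact (Dvd.intro_left _ rfl).trans (Dvd.intro _ rfl)

theorem minorIdeal_le_of_succAbove {N : ℕ} (A : Matrix (Fin N) (Fin (N + 1)) R) (I : Ideal R)
    (h : ∀ j : Fin (N + 1), (A.submatrix id j.succAbove).det ∈ I) : minorIdeal A N ≤ I := by
  rw [minorIdeal_le_iff]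
  intro r c
  by_cases hc : Function.Injective c
  · have : ∃ j, ∀ i, c i ≠ j := by
      by_contra hcon
      push Not at hcon
      simpa using Fintype.card_le_of_surjective c hcon
    obtain ⟨j, hj⟩ := this
    choose σ hσ using fun i => Fin.exists_succAbove_eq (hj i)
    have : A.submatrix r c = (A.submatrix id j.succAbove).submatrix r σ := by
      ext x y
      simp [hσ]
    rw [this]
    exact Ideal.mem_of_dvd _ (det_dvd_det_submatrix _ _ _) (h j)
  · simp only [Function.Injective, not_forall] at hc
    obtain ⟨x, y, hxy, hne⟩ := hc
    rw [Matrix.det_zero_of_column_eq hne fun i => by simp [Matrix.submatrix_apply, hxy]]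
    exact Ideal.zero_mem _

/-- The polynomial `u X - t`. -/
noncomputable def linPoly (u t : R) : Polynomial R :=
  Polynomial.C u * Polynomial.X - Polynomial.C t

theorem coeff_linPoly_mul_X_pow (u t : R) (i k : ℕ) :
    (linPoly u t * Polynomial.X ^ k).coeff i =
      if i = k + 1 then u else if i = k then -t else 0 := by
  rw [Polynomial.coeff_mul_X_pow']
  split_ifs with h1 h2 h3 h2 h3
  · subst h2
    simp [linPoly, Polynomial.coeff_C]
  · subst h3
    simp [linPoly]
  · obtain ⟨l, rfl⟩ : ∃ l, i = k + (l + 2) := ⟨i - k - 2, by omega⟩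
    simp [linPoly]
  · omega
  · omega
  · rfl

/-- Without its constant row, multiplication by `u X - t` is upper triangular with `u` on the
diagonal; without its top row it is lower triangular with `-t` there. -/
theorem det_linPoly_succ (u t : R) (N : ℕ) :
    ((coeffMatrix (N + 1) fun k : Fin N => linPoly u t * Polynomial.X ^ (k : ℕ)).submatrix
      Fin.succ id).det = u ^ N := by
  rw [Matrix.det_of_isUpperTriangular]
  · simp [coeffMatrix, coeff_linPoly_mul_X_pow]
  · intro i j hij
    simp only [id, Fin.lt_def] at hij
    simp only [coeffMatrix, coeff_linPoly_mul_X_pow, Matrix.submatrix_apply, Matrix.of_apply, id,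
      Fin.val_succ]
    rw [if_neg (by omega), if_neg (by omega)]

theorem det_linPoly_castSucc (u t : R) (N : ℕ) :
    ((coeffMatrix (N + 1) fun k : Fin N => linPoly u t * Polynomial.X ^ (k : ℕ)).submatrix
      Fin.castSucc id).det = (-t) ^ N := by
  rw [Matrix.det_of_isLowerTriangular]
  · simp [coeffMatrix, coeff_linPoly_mul_X_pow]
  · intro i j hij
    simp only [OrderDual.toDual_lt_toDual, Fin.lt_def] at hij
    simp only [coeffMatrix, coeff_linPoly_mul_X_pow, Matrix.submatrix_apply, Matrix.of_apply, id,
      Fin.val_castSucc]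
    rw [if_neg (by omega), if_neg (by omega)]

theorem natDegree_linPoly_mul_le {f : Polynomial R} {a : ℕ} (hf : f.natDegree ≤ a)
    (u t : R) : (linPoly u t * f).natDegree ≤ a + 1 := by
  have h1 : (linPoly u t).natDegree ≤ 1 := by
    rw [linPoly, Polynomial.natDegree_sub_C]
    simpa using Polynomial.natDegree_C_mul_X_pow_le u 1
  have := Polynomial.natDegree_mul_le (p := linPoly u t) (q := f)
  omega

variable {f g : Polynomial R} {a b : ℕ} (hf : f.natDegree ≤ a) (hg : g.natDegree ≤ b)
include hf hg

theorem sylvester_linPoly_mul (u t : R) :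
    Polynomial.sylvester (linPoly u t * f) (linPoly u t * g) (a + 1) (b + 1) =
      (coeffMatrix (a + 1 + (b + 1)) fun k : Fin (a + 1 + b) =>
        linPoly u t * Polynomial.X ^ (k : ℕ)) *
      coeffMatrix (a + 1 + b) (sylvesterCols f g (a + 1) (b + 1)) := by
  rw [sylvester_eq_coeffMatrix (natDegree_linPoly_mul_le hf u t)
    (natDegree_linPoly_mul_le hg u t), ← coeffMatrix_mul]
  · simp only [← sylvesterCols_mul]
  · exact natDegree_sylvesterCols_lt hf hg (by omega) (by omega)

theorem minorIdeal_sylvester_linPoly_le (u t : R) :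
    minorIdeal (Polynomial.sylvester (linPoly u t * f) (linPoly u t * g) (a + 1) (b + 1))
      (a + 1 + b) ≤ Ideal.span {Polynomial.resultant f g a b} := by
  rw [sylvester_linPoly_mul hf hg]
  refine (minorIdeal_mul_le_right _ _ _).trans (minorIdeal_le_of_succAbove _ _ fun j => ?_)
  have h := det_coeffMatrix_submatrix hf hg j
  have h3 : ((-1 : R) ^ (j : ℕ)) * (-1) ^ (j : ℕ) = 1 := by rw [← mul_pow]; simp
  rw [Ideal.mem_span_singleton]
  refine ⟨(-1) ^ (j : ℕ) * (-1) ^ (a + 1) * sylvesterKernel f g a b j, ?_⟩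
  linear_combination (-1) ^ (j : ℕ) * h - ((coeffMatrix (a + 1 + b)
      (sylvesterCols f g (a + 1) (b + 1))).submatrix id (Fin.succAbove (n := a + 1 + b) j)).det * h3

/-- The inner dimension of the factorization equals the size of the minor, so choosing rows in the
left factor and columns in the right one gives a product of two determinants. -/
theorem mul_resultant_mem_minorIdeal (u t : R) (s : Fin (a + 1 + b) → Fin (a + 1 + (b + 1)))
    (j : Fin (a + 1 + (b + 1))) :
    ((coeffMatrix (a + 1 + (b + 1)) fun k : Fin (a + 1 + b) =>
      linPoly u t * Polynomial.X ^ (k : ℕ)).submatrix s id).det *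
      (Polynomial.resultant f g a b * sylvesterKernel f g a b j) ∈
    minorIdeal (Polynomial.sylvester (linPoly u t * f) (linPoly u t * g) (a + 1) (b + 1))
      (a + 1 + b) := by
  have h := det_coeffMatrix_submatrix hf hg j
  have h3 : ((-1 : R) ^ (a + 1)) * (-1) ^ (a + 1) = 1 := by rw [← mul_pow]; simp
  have h4 : Polynomial.resultant f g a b * sylvesterKernel f g a b j =
      (-1) ^ (a + 1) * ((-1) ^ (j : ℕ) * ((coeffMatrix (a + 1 + b)
      (sylvesterCols f g (a + 1) (b + 1))).submatrix id
        (Fin.succAbove (n := a + 1 + b) j)).det) := by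
    linear_combination -(-1) ^ (a + 1) * h -
      Polynomial.resultant f g a b * sylvesterKernel f g a b j * h3
  rw [h4, mul_left_comm, mul_left_comm _ ((-1) ^ (j : ℕ)), ← Matrix.det_mul]
  refine Ideal.mul_mem_left _ _ (Ideal.mul_mem_left _ _ ?_)
  have h5 := det_submatrix_mem_minorIdeal (Polynomial.sylvester (linPoly u t * f)
    (linPoly u t * g) (a + 1) (b + 1)) s (Fin.succAbove (n := a + 1 + b) j)
  rw [sylvester_linPoly_mul hf hg] at h5 ⊢
  rwa [Matrix.submatrix_mul _ _ s id _ Function.bijective_id] at h5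

theorem pow_mul_resultant_mem_minorIdeal (u t : R) (j : Fin (a + 1 + (b + 1))) :
    u ^ (a + 1 + b) * (Polynomial.resultant f g a b * sylvesterKernel f g a b j) ∈
    minorIdeal (Polynomial.sylvester (linPoly u t * f) (linPoly u t * g) (a + 1) (b + 1))
      (a + 1 + b) := by
  have h := mul_resultant_mem_minorIdeal hf hg u t (Fin.succ (n := a + 1 + b)) j
  exact det_linPoly_succ u t (a + 1 + b) ▸ h

theorem neg_pow_mul_resultant_mem_minorIdeal (u t : R) (j : Fin (a + 1 + (b + 1))) :
    (-t) ^ (a + 1 + b) * (Polynomial.resultant f g a b * sylvesterKernel f g a b j) ∈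
    minorIdeal (Polynomial.sylvester (linPoly u t * f) (linPoly u t * g) (a + 1) (b + 1))
      (a + 1 + b) := by
  have h := mul_resultant_mem_minorIdeal hf hg u t (Fin.castSucc (n := a + 1 + b)) j
  exact det_linPoly_castSucc u t (a + 1 + b) ▸ h

theorem det_sylvester_linPoly_mul (u t : R) :
    (Polynomial.sylvester (linPoly u t * f) (linPoly u t * g) (a + 1) (b + 1)).det = 0 := by
  have hk : (Polynomial.sylvester (linPoly u t * f) (linPoly u t * g) (a + 1) (b + 1)).det ∈
      minorIdeal (coeffMatrix (a + 1 + (b + 1)) fun k : Fin (a + 1 + b) =>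
        linPoly u t * Polynomial.X ^ (k : ℕ)) (a + 1 + (b + 1)) := by
    have h := det_submatrix_mem_minorIdeal (Polynomial.sylvester (linPoly u t * f)
      (linPoly u t * g) (a + 1) (b + 1)) id id
    rw [Matrix.submatrix_id_id] at h
    rw [sylvester_linPoly_mul hf hg] at h ⊢
    exact minorIdeal_mul_le_left _ _ _ h
  have h0 : minorIdeal (coeffMatrix (a + 1 + (b + 1)) fun k : Fin (a + 1 + b) =>
        linPoly u t * Polynomial.X ^ (k : ℕ)) (a + 1 + (b + 1)) ≤ ⊥ := by
    rw [minorIdeal_le_iff]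
    intro r c
    have hc : ¬ Function.Injective c := fun hc => by
      have := Fintype.card_le_of_injective c hc
      simp only [Fintype.card_fin] at this
      omega
    simp only [Function.Injective, not_forall] at hc
    obtain ⟨x, y, hxy, hne⟩ := hc
    rw [Matrix.det_zero_of_column_eq hne fun i => by simp [Matrix.submatrix_apply, hxy]]
    exact Ideal.zero_mem _
  exact (Submodule.mem_bot R).1 (h0 hk)

/-- The first principal subresultant of two polynomials with the common factor `u X - t`. -/
theorem subresultant_linPoly_mul (u t : R) :
    Matrix.det (Matrix.of fun i j : Fin (b + a) => (j.addCases
      (fun j => (Polynomial.X ^ (j : ℕ) * (linPoly u t * f)).coeff (i + 1))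
      (fun j => (Polynomial.X ^ (j : ℕ) * (linPoly u t * g)).coeff (i + 1)) : R)) =
    (-1) ^ (a * b) * u ^ (a + b) * Polynomial.resultant f g a b := by
  -- Starting the rows at the coefficient of degree `1` removes the constant row of multiplication
  -- by `u X - t`. The remaining factor is the Sylvester matrix of `g, f`, whence the sign `(-1) ^
  -- (a * b)`.
  have h : (Matrix.of fun i j : Fin (b + a) => (j.addCases
      (fun j => (Polynomial.X ^ (j : ℕ) * (linPoly u t * f)).coeff (i + 1))
      (fun j => (Polynomial.X ^ (j : ℕ) * (linPoly u t * g)).coeff (i + 1)) : R)) =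
      (coeffMatrix (b + a + 1) (fun j => linPoly u t * sylvesterCols g f b a j)).submatrix
        Fin.succ id := by
    ext i j
    induction j using Fin.addCases <;>
      simp [coeffMatrix, sylvesterCols, mul_left_comm]
  have hdeg := natDegree_sylvesterCols_lt hg hf (m := b) (n := a) (N := b + a) (by omega) (by omega)
  rw [h, coeffMatrix_mul _ _ (b + a) _ hdeg, Matrix.submatrix_mul _ _ _ id _ Function.bijective_id,
    Matrix.det_mul, det_linPoly_succ, Matrix.submatrix_id_id, ← sylvester_eq_coeffMatrix hg hf,
    ← Polynomial.resultant, Polynomial.resultant_comm, mul_comm b a, add_comm b a]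
  ring

end Linear

/-! ### A lower bound for the rank of a Sylvester matrix. -/

section Rank

variable {D : Type*} [CommRing D] [IsDomain D]

/-- The first `m` shifts of a nonzero polynomial form a triangular block with its leading
coefficient on the diagonal. There are exactly `m` shifts of `Q`; when `Q = 0`, the bound `m ≤ e`
provides enough shifts of `P`. -/
theorem exists_det_submatrix_sylvester_ne_zero {P Q : Polynomial D} {m e : ℕ} (hme : m ≤ e)
    (hP : P.natDegree ≤ m) (hQ : Q.natDegree ≤ e) (h : P ≠ 0 ∨ Q ≠ 0) :
    ∃ r c : Fin m → Fin (m + e), ((Polynomial.sylvester P Q m e).submatrix r c).det ≠ 0 := by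
  have key : ∀ (T : Polynomial D) (d : ℕ) (hd : d ≤ e), T ≠ 0 → T.natDegree = d →
      ∀ c : Fin m → Fin (m + e), (∀ j, sylvesterCols P Q m e (c j) = Polynomial.X ^ (j : ℕ) * T) →
      ∃ r c : Fin m → Fin (m + e), ((Polynomial.sylvester P Q m e).submatrix r c).det ≠ 0 := by
    intro T d hd hT hTd c hc
    refine ⟨fun i => ⟨i + d, by omega⟩, c, ?_⟩
    rw [sylvester_eq_coeffMatrix hP hQ, Matrix.det_of_isUpperTriangular]
    · rw [Finset.prod_ne_zero_iff]
      intro i _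
      simp only [coeffMatrix, Matrix.submatrix_apply, Matrix.of_apply, hc]
      rw [add_comm, Polynomial.coeff_X_pow_mul, ← hTd, Polynomial.coeff_natDegree]
      exact Polynomial.leadingCoeff_ne_zero.2 hT
    · intro i j hij
      simp only [id, Fin.lt_def] at hij
      simp only [coeffMatrix, Matrix.submatrix_apply, Matrix.of_apply, hc]
      rw [Polynomial.coeff_X_pow_mul', if_pos (by omega)]
      exact Polynomial.coeff_eq_zero_of_natDegree_lt (by omega)
  by_cases hQ0 : Q = 0
  · refine key P _ (hP.trans hme) (h.resolve_right (not_not.2 hQ0)) rfl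
      (fun j => Fin.natAdd m (Fin.castLE hme j)) fun j => ?_
    simp [sylvesterCols]
  · refine key Q _ hQ hQ0 rfl (fun j => Fin.castAdd e j) fun j => ?_
    simp [sylvesterCols]

end Rank

/-! ### Binary forms and dehomogenization. -/

section Forms

variable {R : Type*} [CommRing R]

theorem aeval_mul_of_isHomogeneous {S σ : Type*} [CommRing S] [Algebra R S]
    {F : MvPolynomial σ R} {d : ℕ} (hF : F.IsHomogeneous d) (c : S) (y : σ → S) :
    aeval (fun i => c * y i) F = c ^ d * aeval y F := by
  simp only [aeval_def, eval₂_eq, Finset.mul_sum]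
  refine Finset.sum_congr rfl fun m hm => ?_
  have hd : ∑ i ∈ m.support, m i = d := by
    rw [hF.degree_eq_sum_deg_support hm]
  simp only [mul_pow, Finset.prod_mul_distrib, Finset.prod_pow_eq_pow_sum, hd]
  ring

theorem dehom_eq_sum (F : MvPolynomial (Fin 2) R) :
    dehom R F = ∑ m ∈ F.support, Polynomial.C (F.coeff m) * Polynomial.X ^ m 0 := by
  simp [dehom, aeval_def, eval₂_eq', Fin.prod_univ_two, Polynomial.algebraMap_eq]

theorem degree_eq_add (m : Fin 2 →₀ ℕ) : m.degree = m 0 + m 1 := by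
  simp [Finsupp.degree_eq_sum, Fin.sum_univ_two]

theorem coeff_dehom {F : MvPolynomial (Fin 2) R} {d : ℕ} (hF : F.IsHomogeneous d)
    {m : Fin 2 →₀ ℕ} (hm : m.degree = d) : (dehom R F).coeff (m 0) = F.coeff m := by
  rw [dehom_eq_sum, Polynomial.finsetSum_coeff, Finset.sum_eq_single m]
  · simp
  · intro m' hm' hne
    have hd' : m'.degree = d := by
      by_contra hcon
      exact mem_support_iff.1 hm' (hF.coeff_eq_zero hcon)
    rw [degree_eq_add] at hm hd'
    rw [Polynomial.coeff_C_mul_X_pow, if_neg]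
    intro h0
    refine hne (Finsupp.ext fun i => ?_)
    fin_cases i
    · exact h0.symm
    · change m' 1 = m 1
      omega
  · intro hm
    simp [notMem_support_iff.1 hm]

theorem natDegree_dehom_le {F : MvPolynomial (Fin 2) R} {d : ℕ} (hF : F.IsHomogeneous d) :
    (dehom R F).natDegree ≤ d := by
  rw [dehom_eq_sum]
  refine Polynomial.natDegree_sum_le_of_forall_le _ _ fun m hm => ?_
  refine (Polynomial.natDegree_C_mul_X_pow_le _ _).trans ?_
  have hd' : m.degree = d := by
    by_contra hcon
    exact mem_support_iff.1 hm (hF.coeff_eq_zero hcon)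
  rw [degree_eq_add] at hd'
  omega

theorem eq_zero_of_dehom_eq_zero {F : MvPolynomial (Fin 2) R} {d : ℕ} (hF : F.IsHomogeneous d)
    (h : dehom R F = 0) : F = 0 := by
  ext m
  by_cases hm : m.degree = d
  · rw [← coeff_dehom hF hm, h]
    simp
  · rw [hF.coeff_eq_zero hm, coeff_zero]

theorem coeff_dehom_eq_aeval {F : MvPolynomial (Fin 2) R} {d : ℕ} (hF : F.IsHomogeneous d)
    (S : Type*) [CommRing S] [Algebra R S] :
    algebraMap R S ((dehom R F).coeff d) = aeval ![(1 : S), 0] F := by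
  have h := coeff_dehom hF (m := Finsupp.single 0 d) (by simp)
  rw [Finsupp.single_eq_same] at h
  rw [h, aeval_def, eval₂_eq', Finset.sum_eq_single (Finsupp.single 0 d)]
  · simp [Fin.prod_univ_two]
  · intro m hm hne
    have hd' : m.degree = d := by
      by_contra hcon
      exact mem_support_iff.1 hm (hF.coeff_eq_zero hcon)
    rw [degree_eq_add] at hd'
    have : m 1 ≠ 0 := fun h0 => hne (Finsupp.ext fun i => by
      fin_cases i
      · simpa [h0] using hd'
      · simpa using h0)
    simp [Fin.prod_univ_two, this]
  · intro hm
    simp [notMem_support_iff.1 hm]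

theorem aeval_dehom (F : MvPolynomial (Fin 2) R) {S : Type*} [CommRing S] [Algebra R S] (x : S) :
    Polynomial.aeval x (dehom R F) = aeval ![x, 1] F := by
  have : (Polynomial.aeval x).comp (dehom R) = aeval ![x, 1] := by
    ext i
    fin_cases i <;> simp [dehom]
  exact DFunLike.congr_fun this F

theorem dehom_map {S : Type*} [CommRing S] (φ : R →+* S) (F : MvPolynomial (Fin 2) R) :
    dehom S (map φ F) = (dehom R F).map φ := by
  have : (dehom S : MvPolynomial (Fin 2) S →+* Polynomial S).comp (map φ) =
      (Polynomial.mapRingHom φ).comp (dehom R : MvPolynomial (Fin 2) R →+* Polynomial R) := by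
    ext i
    · simp [dehom]
    · fin_cases i <;> simp [dehom]
  exact DFunLike.congr_fun this F

theorem aeval_sub_aeval_mem {S σ : Type*} [CommRing S] [Algebra R S] (I : Ideal S)
    (F : MvPolynomial σ R) (x y : σ → S) (h : ∀ i, x i - y i ∈ I) :
    aeval x F - aeval y F ∈ I := by
  have hxy : ∀ i, Ideal.Quotient.mkₐ R I (x i) = Ideal.Quotient.mkₐ R I (y i) := fun i =>
    Ideal.Quotient.eq.2 (h i)
  refine Ideal.Quotient.eq.1 ?_
  change Ideal.Quotient.mkₐ R I _ = Ideal.Quotient.mkₐ R I _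
  rw [comp_aeval_apply, comp_aeval_apply]
  simp only [hxy]

/-- A form of degree `d` is congruent to its value at `x` modulo the linear form vanishing at
`x`. -/
theorem linear_dvd_sub {F : MvPolynomial (Fin 2) R} {d : ℕ} (hF : F.IsHomogeneous d)
    (x : Fin 2 → R) (j : Fin 2) :
    (X 0 * C (x 1) - C (x 0) * X 1) ∣ C (x j) ^ d * F - X j ^ d * C (eval x F) := by
  rw [← Ideal.mem_span_singleton]
  have h1 := aeval_mul_of_isHomogeneous hF (C (x j) : MvPolynomial (Fin 2) R) X
  have h2 := aeval_mul_of_isHomogeneous hF (X j : MvPolynomial (Fin 2) R) (fun i => C (x i))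
  have h3 : aeval (fun i => (C (x i) : MvPolynomial (Fin 2) R)) F = C (eval x F) := by
    have := comp_aeval_apply (R := R) (f := x) (Algebra.ofId R (MvPolynomial (Fin 2) R)) F
    rw [aeval_eq_eval] at this
    exact this.symm
  rw [aeval_X_left_apply] at h1
  rw [h3] at h2
  rw [← h1, ← h2]
  -- By homogeneity the two terms are `F(x_j X)` and `F(X_j x)`, whose arguments differ by `0` or by
  -- plus or minus the linear form.
  refine aeval_sub_aeval_mem _ _ _ _ fun i => Ideal.mem_span_singleton.2 ?_
  fin_cases j <;> fin_cases i
  · exact ⟨0, by simp [mul_comm]⟩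
  · exact ⟨-1, by simp only [Fin.zero_eta, Fin.mk_one]; ring⟩
  · exact ⟨1, by simp only [Fin.zero_eta, Fin.mk_one]; ring⟩
  · exact ⟨0, by simp [mul_comm]⟩

end Forms

/-! ### Cross products, proportional vectors and linear divisors. -/

section Cross

/-- The cross product of two vectors. -/
def cross {R : Type*} [CommRing R] (p q : Fin 3 → R) : Fin 3 → R :=
  ![p 1 * q 2 - p 2 * q 1, p 2 * q 0 - p 0 * q 2, p 0 * q 1 - p 1 * q 0]

theorem mul_cross_eq_of_orthogonal {R : Type*} [CommRing R] {p q y : Fin 3 → R}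
    (hp : ∑ i, y i * p i = 0) (hq : ∑ i, y i * q i = 0) (i j : Fin 3) :
    y i * cross p q j = y j * cross p q i := by
  rw [Fin.sum_univ_three] at hp hq
  fin_cases i <;> fin_cases j <;> simp [cross]
  · linear_combination p 2 * hq - q 2 * hp
  · linear_combination -p 1 * hq + q 1 * hp
  · linear_combination -p 2 * hq + q 2 * hp
  · linear_combination p 0 * hq - q 0 * hp
  · linear_combination p 1 * hq - q 1 * hp
  · linear_combination -p 0 * hq + q 0 * hp

theorem dvd_of_forall_dvd_mul {R ι : Type*} [CommRing R] [IsDomain R]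
    [UniqueFactorizationMonoid R] [Fintype ι] {f : ι → R}
    (hf : ∀ g, (∀ i, g ∣ f i) → IsUnit g) {e c : R} (h : ∀ i, e ∣ c * f i) : e ∣ c := by
  obtain ⟨_⟩ := (inferInstance : Nonempty (NormalizedGCDMonoid R))
  have hu : IsUnit (Finset.univ.gcd f) := hf _ fun i => Finset.gcd_dvd (Finset.mem_univ i)
  have h1 : e ∣ Finset.univ.gcd (fun i => c * f i) := Finset.dvd_gcd fun i _ => h i
  exact hu.dvd_mul_right.1 (((Finset.gcd_mul_left' _ f c).dvd_iff_dvd_right).1 h1)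

theorem exists_eq_mul_of_proportional {R ι : Type*} [CommRing R] [IsDomain R]
    [UniqueFactorizationMonoid R] [Fintype ι] [Nonempty ι] {f w : ι → R}
    (hf : ∀ g, (∀ i, g ∣ f i) → IsUnit g) (h : ∀ i j, f i * w j = f j * w i) :
    ∃ c, ∀ i, w i = c * f i := by
  have hf0 : ∃ i, f i ≠ 0 := by
    by_contra hcon
    push Not at hcon
    exact not_isUnit_zero (hf 0 fun i => by simp [hcon i])
  obtain ⟨i, hi⟩ := hf0
  obtain ⟨c, hc⟩ : f i ∣ w i := dvd_of_forall_dvd_mul hf fun j => ⟨w j, by rw [h i j]; ring⟩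
  refine ⟨c, fun j => mul_left_cancel₀ hi ?_⟩
  rw [h i j, hc]
  ring

/-- Vanishing at `(t, u)` gives divisibility after multiplication by `u ^ d`. As `u` is prime and
does not divide the linear form, whose other coefficient is `-t`, this power can be cancelled. -/
theorem linear_dvd_of_eval_eq_zero {R : Type*} [CommRing R] [IsDomain R]
    {F : MvPolynomial (Fin 2) R} {d : ℕ} (hF : F.IsHomogeneous d) {t u : R} (hu : Prime u)
    (hut : ¬ u ∣ t) (h0 : eval ![t, u] F = 0) : X 0 * C u - C t * X 1 ∣ F := by
  have h : X 0 * C u - C t * X 1 ∣ C u ^ d * F := by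
    have h := linear_dvd_sub hF ![t, u] 1
    rw [h0, C_0, mul_zero, sub_zero] at h
    exact h
  obtain ⟨A, hA⟩ := h
  have hprime : Prime (C u : MvPolynomial (Fin 2) R) := (MvPolynomial.prime_C_iff _).2 hu
  have hnd : ¬ (C u : MvPolynomial (Fin 2) R) ∣ X 0 * C u - C t * X 1 := by
    rintro ⟨B, hB⟩
    have h1 := congrArg (eval ![0, 1]) hB
    simp only [map_sub, map_mul, eval_X, eval_C, Matrix.cons_val_zero, Matrix.cons_val_one,
      zero_mul, mul_one, zero_sub] at h1
    exact hut ((dvd_neg).1 ⟨_, h1⟩)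
  obtain ⟨A', rfl⟩ := hprime.pow_dvd_of_dvd_mul_left d hnd (Dvd.intro _ hA)
  refine ⟨A', mul_left_cancel₀ (pow_ne_zero d hprime.ne_zero) ?_⟩
  rw [hA, mul_left_comm]

end Cross

/-! ### The syzygies of the parameterization and its common zeros. -/

variable {K : Type*} [Field K] {n μ : ℕ} {f p q : Fin 3 → MvPolynomial (Fin 2) K}

theorem dehom_linForm {R : Type*} [CommRing R] [Algebra K R] (p : Fin 3 → MvPolynomial (Fin 2) K)
    (y : Fin 3 → R) : dehom R (linForm p y) =
      ∑ i, Polynomial.C (y i) * (dehom K (p i)).map (algebraMap K R) := by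
  have hC : ∀ r, dehom R (C r) = Polynomial.C r := fun r => by
    rw [← algebraMap_eq, AlgHom.commutes, Polynomial.algebraMap_eq]
  simp [linForm, dehom_map, hC]

theorem isHomogeneous_linForm {R : Type*} [CommRing R] [Algebra K R] {d : ℕ}
    (hp : ∀ i, (p i).IsHomogeneous d) (y : Fin 3 → R) : (linForm p y).IsHomogeneous d :=
  IsHomogeneous.sum _ _ _ fun i _ => ((hp i).map _).C_mul _

theorem sum_mul_eq_zero_of_mem_syzygies (hp : p ∈ syzygies f) : ∑ i, f i * p i = 0 := by
  have h : ∑ i, p i • f i = 0 := hp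
  simpa [mul_comm] using h

theorem diag_dvd_phiForm {d : ℕ} (hp : ∀ i, (p i).IsHomogeneous d) (hpf : ∑ i, f i * p i = 0) :
    diag K ∣ phiForm f p := by
  have h0 : eval ![X 0, X 1] (phiForm f p) = 0 := by
    have hX : (![X 0, X 1] : Fin 2 → MvPolynomial (Fin 2) K) = X := by
      ext1 i
      fin_cases i <;> rfl
    rw [← hpf, hX, phiForm, linForm, map_sum]
    refine Finset.sum_congr rfl fun i _ => ?_
    rw [map_mul, eval_C, eval_map, algebraMap_eq, eval₂_eta]
  refine linear_dvd_of_eval_eq_zero (isHomogeneous_linForm hp f) X_prime ?_ h0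
  rw [X_dvd_X]
  simp

theorem diag_mul_divDiag {F : MvPolynomial (Fin 2) (MvPolynomial (Fin 2) K)} (h : diag K ∣ F) :
    diag K * divDiag F = F := by
  rw [divDiag, dif_pos h]
  exact h.choose_spec.symm

theorem dehom_diag : dehom _ (diag K) = linPoly (X 1) (X 0) := by
  have hC : ∀ r : MvPolynomial (Fin 2) K, dehom _ (C r) = Polynomial.C r := fun r => by
    rw [← algebraMap_eq, AlgHom.commutes, Polynomial.algebraMap_eq]
  have hX : ∀ i, dehom (MvPolynomial (Fin 2) K) (X i) = ![Polynomial.X, 1] i := fun i => aeval_X _ _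
  rw [diag, map_sub, map_mul, map_mul, hC, hC, hX, hX, linPoly]
  simp only [Matrix.cons_val_zero, Matrix.cons_val_one]
  ring

namespace IsMuBasis

variable (h : IsMuBasis n μ f p q)
include h

theorem left_mem : p ∈ syzygies f := h.span_eq ▸ Submodule.subset_span (by simp)

theorem right_mem : q ∈ syzygies f := h.span_eq ▸ Submodule.subset_span (by simp)

theorem sum_mul_left : ∑ i, f i * p i = 0 := sum_mul_eq_zero_of_mem_syzygies h.left_mem

theorem sum_mul_right : ∑ i, f i * q i = 0 := sum_mul_eq_zero_of_mem_syzygies h.right_mem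

/-- The Hilbert-Burch theorem for a `μ`-basis. -/
theorem cross_eq (hf : IsProperParam n f) :
    ∃ c : K, c ≠ 0 ∧ ∀ i, cross p q i = C c * f i := by
  obtain ⟨c, hc⟩ := exists_eq_mul_of_proportional hf.gcd_eq_one
    (mul_cross_eq_of_orthogonal h.sum_mul_left h.sum_mul_right)
  have hne : ∃ i, cross p q i ≠ 0 := by
    by_contra hcon
    push Not at hcon
    have hli := LinearIndependent.pair_iff.1 h.linearIndependent
    have h0 := hcon 0
    have h1 := hcon 1
    have h2 := hcon 2
    simp only [cross, Matrix.cons_val_zero, Matrix.cons_val_one, Matrix.cons_val] at h0 h1 h2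
    -- A zero cross product gives the relation `q i • p - p i • q = 0`, so independence kills `q`,
    -- and then `q` itself contradicts independence.
    have hq : ∀ i, q i = 0 := fun i => by
      refine (hli (q i) (-p i) ?_).1
      ext1 j
      simp only [Pi.add_apply, Pi.smul_apply, smul_eq_mul, Pi.zero_apply]
      fin_cases i <;> fin_cases j <;> simp only [Fin.zero_eta, Fin.mk_one, Fin.reduceFinMk]
      · ring
      · linear_combination -h2
      · linear_combination h1
      · linear_combination h2
      · ring
      · linear_combination -h0
      · linear_combination -h1
      · linear_combination h0
      · ring
    have := (hli 0 1 (by rw [zero_smul, zero_add, one_smul]; exact _root_.funext hq)).2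
    exact one_ne_zero this
  obtain ⟨i, hi⟩ := hne
  have hμ : μ + (n - μ) = n := by have := h.two_mul_le; omega
  have hw : (cross p q i).IsHomogeneous n := by
    have hpq : ∀ i j, (p i * q j).IsHomogeneous n := fun i j =>
      hμ ▸ (h.homogeneous_left i).mul (h.homogeneous_right j)
    fin_cases i <;> exact (hpq _ _).sub (hpq _ _)
  have hci := hc i
  have hc0 : c ≠ 0 := by rintro rfl; exact hi (by simp [hci])
  have hfi : f i ≠ 0 := by intro h0; exact hi (by simp [hci, h0])
  -- Both `cross p q i` and `f i` have degree `n`, so the proportionality factor has degree `0`.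
  have hdeg := hw.totalDegree hi
  rw [hci, totalDegree_mul_of_isDomain hc0 hfi, (hf.homogeneous i).totalDegree hfi] at hdeg
  have hcC := (totalDegree_eq_zero_iff_eq_C (p := c)).1 (by omega)
  refine ⟨c.coeff 0, fun h0 => hc0 (by rw [hcC, h0, C_0]), fun j => ?_⟩
  rw [← hcC, hc j]

end IsMuBasis

theorem IsProperParam.not_isUnit (hf : IsProperParam n f) (hn : n ≠ 0) (i : Fin 3) :
    ¬ IsUnit (f i) := by
  intro hu
  have h := (hf.homogeneous i).totalDegree hu.ne_zero
  rw [isUnit_iff_totalDegree_of_isReduced] at hu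
  omega

/-- A common zero of forms yields a common linear factor, which vanishes at `x` and so is not a
unit. -/
theorem IsProperParam.exists_eval_ne_zero (hf : IsProperParam n f) {x : Fin 2 → K} (hx : x ≠ 0) :
    ∃ i, eval x (f i) ≠ 0 := by
  by_contra hcon
  push Not at hcon
  obtain ⟨j, hj⟩ := Function.ne_iff.1 hx
  have hu := hf.gcd_eq_one (X 0 * C (x 1) - C (x 0) * X 1) fun i => by
    have h := linear_dvd_sub (hf.homogeneous i) x j
    rw [hcon, C_0, mul_zero, sub_zero] at h
    exact (((isUnit_iff_ne_zero.2 hj).map C).pow n).dvd_mul_left.1 h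
  have h0 := hu.map (eval x)
  simp [mul_comm] at h0

theorem IsProperParam.span_dehom_eq_top [IsAlgClosed K] (hf : IsProperParam n f) :
    Ideal.span (Set.range fun i => dehom K (f i)) = ⊤ := by
  obtain ⟨g, hg⟩ := (IsPrincipalIdealRing.principal
    (Ideal.span (Set.range fun i => dehom K (f i)))).principal
  change _ = Ideal.span {g} at hg
  rw [hg, Ideal.span_singleton_eq_top]
  by_contra hu
  have hroot : ∃ x, g.IsRoot x := by
    by_cases hg0 : g = 0
    · exact ⟨0, by simp [hg0]⟩
    · exact IsAlgClosed.exists_root g (mt (Polynomial.isUnit_iff_degree_eq_zero).2 hu)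
  obtain ⟨x, hx⟩ := hroot
  obtain ⟨i, hi⟩ := hf.exists_eval_ne_zero (x := ![x, 1])
    (fun h => one_ne_zero (congrFun h 1 : (1 : K) = 0))
  apply hi
  have hdvd : g ∣ dehom K (f i) := by
    rw [← Ideal.mem_span_singleton, ← hg]
    exact Ideal.subset_span ⟨i, rfl⟩
  have := aeval_dehom (f i) x
  rw [Polynomial.coe_aeval_eq_eval, aeval_eq_eval] at this
  rw [← this]
  exact hx.dvd hdvd

/-- The coefficient vectors of a `μ`-basis span the space. -/
theorem IsMuBasis.span_coeff_eq_top (h : IsMuBasis n μ f p q) (hf : IsProperParam n f)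
    (hn : n ≠ 0) :
    Submodule.span K (Set.range (fun k i => (dehom K (p i)).coeff k) ∪
      Set.range (fun k i => (dehom K (q i)).coeff k)) = ⊤ := by
  by_contra hlt
  obtain ⟨g, hg0, hg⟩ := Submodule.exists_le_ker_of_lt_top _ (lt_top_iff_ne_top.2 hlt)
  have hgv : ∀ v : Fin 3 → K, g v = ∑ i, g (Pi.single i 1) * v i := fun v => by
    conv_lhs => rw [← LinearMap.sum_single_apply (fun _ => K) v]
    rw [map_sum]
    refine Finset.sum_congr rfl fun i _ => ?_
    have : Pi.single i (v i) = v i • (Pi.single i 1 : Fin 3 → K) := by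
      ext j
      simp [Pi.single_apply]
    rw [this, map_smul, smul_eq_mul, mul_comm]
  have horth : ∀ (r : Fin 3 → MvPolynomial (Fin 2) K) (d : ℕ), (∀ i, (r i).IsHomogeneous d) →
      (∀ k, g (fun i => (dehom K (r i)).coeff k) = 0) →
      ∑ i, C (g (Pi.single i 1)) * r i = 0 := by
    intro r d hr hk
    refine eq_zero_of_dehom_eq_zero (IsHomogeneous.sum _ _ d fun i _ => (hr i).C_mul _) ?_
    ext k
    rw [map_sum, Polynomial.finsetSum_coeff, Polynomial.coeff_zero, ← hk k, hgv]
    refine Finset.sum_congr rfl fun i _ => ?_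
    rw [C_mul', map_smul, Polynomial.coeff_smul, smul_eq_mul]
  have hp := horth p μ h.homogeneous_left fun k =>
    hg (Submodule.subset_span (Or.inl ⟨k, rfl⟩))
  have hq := horth q _ h.homogeneous_right fun k =>
    hg (Submodule.subset_span (Or.inr ⟨k, rfl⟩))
  obtain ⟨c, hc0, hc⟩ := h.cross_eq hf
  have hw : ∃ i, g (Pi.single i 1) ≠ 0 := by
    by_contra hcon
    push Not at hcon
    exact hg0 (LinearMap.ext fun v => by simp [hgv v, hcon])
  obtain ⟨i, hi⟩ := hw
  -- The constant vector of coefficients of `g` is orthogonal to `p` and `q`, hence proportional to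
  -- `f`. A nonzero entry `i` makes `f i` divide every `f j`.
  refine hf.not_isUnit hn i (hf.gcd_eq_one _ fun j => ?_)
  have hij := mul_cross_eq_of_orthogonal hp hq i j
  rw [hc, hc] at hij
  have hu : IsUnit (C (g (Pi.single i 1)) * C c : MvPolynomial (Fin 2) K) :=
    ((isUnit_iff_ne_zero.2 hi).map C).mul ((isUnit_iff_ne_zero.2 hc0).map C)
  rw [← hu.dvd_mul_left, mul_assoc, hij]
  exact ⟨C (g (Pi.single j 1)) * C c, by ring⟩

/-- The `K`-linear map `v ↦ d * ∑ y i * v i` sends the coefficient vectors of `p` and `q` into `I`.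
They span, so it also sends the basis vectors into `I`. -/
theorem IsMuBasis.mul_mem_of_coeff_mem (h : IsMuBasis n μ f p q) (hf : IsProperParam n f)
    (hn : n ≠ 0) {R : Type*} [CommRing R] [Algebra K R] (I : Ideal R) (d : R) (y : Fin 3 → R)
    (hp : ∀ k, d * (dehom R (linForm p y)).coeff k ∈ I)
    (hq : ∀ k, d * (dehom R (linForm q y)).coeff k ∈ I) (i : Fin 3) : d * y i ∈ I := by
  let Λ : (Fin 3 → K) →ₗ[K] R := LinearMap.mulLeft K d ∘ₗ Fintype.linearCombination K y
  have hΛ : ∀ v, Λ v = d * ∑ i, y i * algebraMap K R (v i) := fun v => by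
    simp [Λ, Fintype.linearCombination_apply, Algebra.smul_def, mul_comm, Finset.mul_sum]
  have hle : Submodule.span K (Set.range (fun k i => (dehom K (p i)).coeff k) ∪
      Set.range (fun k i => (dehom K (q i)).coeff k)) ≤
      (I.restrictScalars K).comap Λ := by
    rw [Submodule.span_le]
    rintro _ (⟨k, rfl⟩ | ⟨k, rfl⟩)
    · have := hp k
      simpa [hΛ, dehom_linForm] using this
    · have := hq k
      simpa [hΛ, dehom_linForm] using this
  rw [h.span_coeff_eq_top hf hn] at hle
  have := hle (Submodule.mem_top (x := Pi.single i 1))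
  simpa [hΛ, Pi.single_apply, apply_ite] using this

/-- For a resultant with formal degrees, `hlead` excludes a common root at infinity. One polynomial
then attains its formal degree, and the formal degree of the other can be lowered at the cost of
nonzero factors. -/
theorem resultant_ne_zero_of_no_common_root {Ω : Type*} [Field Ω] [IsAlgClosed Ω]
    {P Q : Polynomial Ω} {a b : ℕ} (hP : P.natDegree ≤ a) (hQ : Q.natDegree ≤ b)
    (hlead : ¬ (P.coeff a = 0 ∧ Q.coeff b = 0)) (hroot : ∀ x, ¬ (P.eval x = 0 ∧ Q.eval x = 0)) :
    Polynomial.resultant P Q a b ≠ 0 := by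
  have hres : ∀ {P Q : Polynomial Ω}, (∀ x, ¬ (P.eval x = 0 ∧ Q.eval x = 0)) →
      Polynomial.resultant P Q ≠ 0 := by
    intro P Q hroot h0
    refine (Polynomial.resultant_eq_zero_iff.1 h0).2 ?_
    rw [Polynomial.isCoprime_iff_aeval_ne_zero_of_isAlgClosed Ω Ω]
    intro x
    have := hroot x
    simp only [Polynomial.coe_aeval_eq_eval]
    tauto
  have key : ∀ {P Q : Polynomial Ω} {a b : ℕ}, P.natDegree ≤ a → Q.natDegree ≤ b →
      P.coeff a ≠ 0 → (∀ x, ¬ (P.eval x = 0 ∧ Q.eval x = 0)) →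
      Polynomial.resultant P Q a b ≠ 0 := by
    intro P Q a b hP hQ hPa hroot
    have ha : P.natDegree = a := Polynomial.natDegree_eq_of_le_of_coeff_ne_zero hP hPa
    obtain ⟨k, rfl⟩ := Nat.exists_eq_add_of_le hQ
    rw [Polynomial.resultant_add_right_deg _ _ _ _ _ le_rfl]
    refine mul_ne_zero (pow_ne_zero _ hPa) ?_
    rw [← ha]
    exact hres hroot
  by_cases hPa : P.coeff a = 0
  · rw [Polynomial.resultant_comm]
    refine mul_ne_zero (pow_ne_zero _ (neg_ne_zero.2 one_ne_zero)) (key hQ hP ?_ ?_)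
    · exact fun h => hlead ⟨hPa, h⟩
    · exact fun x h => hroot x h.symm
  · exact key hP hQ hPa hroot

theorem coeff_linPoly_mul {R : Type*} [CommRing R] (u t : R) {g : Polynomial R} {a : ℕ}
    (hg : g.natDegree ≤ a) : (linPoly u t * g).coeff (a + 1) = u * g.coeff a := by
  rw [linPoly, sub_mul, mul_assoc, Polynomial.coeff_sub, Polynomial.coeff_C_mul,
    Polynomial.coeff_X_mul, Polynomial.coeff_C_mul,
    Polynomial.coeff_eq_zero_of_natDegree_lt (Nat.lt_succ_of_le hg), mul_zero, sub_zero]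

theorem map_cross {R S : Type*} [CommRing R] [CommRing S] (φ : R →+* S) (p q : Fin 3 → R)
    (i : Fin 3) : φ (cross p q i) = cross (fun i => φ (p i)) (fun i => φ (q i)) i := by
  fin_cases i <;> simp [cross]

variable {K : Type*} [Field K] {n μ : ℕ} {f p q : Fin 3 → MvPolynomial (Fin 2) K}

theorem IsProperParam.isUnit_of_dvd_dehom [IsAlgClosed K] (hf : IsProperParam n f)
    (g : Polynomial K) (hg : ∀ i, g ∣ dehom K (f i)) : IsUnit g := by
  rw [← Ideal.span_singleton_eq_top, eq_top_iff, ← hf.span_dehom_eq_top, Ideal.span_le]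
  rintro _ ⟨i, rfl⟩
  exact Ideal.mem_span_singleton.2 (hg i)

/-! ### The generic point of the curve. -/

variable {Ω : Type*} [Field Ω] [Algebra K Ω]

/-- At finite points, the Bézout relation between the `f i` over `K` survives in `Ω`; the point at
infinity is already defined over `K`. -/
theorem IsProperParam.exists_aeval_ne_zero [IsAlgClosed K] (hf : IsProperParam n f)
    {σ : Fin 2 → Ω} (hσ : σ ≠ 0) : ∃ i, aeval σ (f i) ≠ 0 := by
  by_cases h1 : σ 1 = 0
  · have h0 : σ 0 ≠ 0 := fun h0 => hσ (funext fun i => by fin_cases i <;> assumption)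
    have hσ' : σ = fun i => σ 0 * (![1, 0] : Fin 2 → Ω) i := by
      ext i
      fin_cases i <;> simp [h1]
    obtain ⟨i, hi⟩ := hf.exists_eval_ne_zero (x := ![1, 0])
      (fun h => one_ne_zero (congrFun h 0 : (1 : K) = 0))
    refine ⟨i, ?_⟩
    rw [hσ', aeval_mul_of_isHomogeneous (hf.homogeneous i)]
    refine mul_ne_zero (pow_ne_zero _ h0) ?_
    rw [← coeff_dehom_eq_aeval (hf.homogeneous i)]
    have h := coeff_dehom_eq_aeval (hf.homogeneous i) K
    rw [aeval_eq_eval] at h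
    rw [Algebra.algebraMap_self, RingHom.id_apply] at h
    rw [h]
    exact (map_ne_zero _).2 hi
  · have hσ' : σ = fun i => σ 1 * (![σ 0 / σ 1, 1] : Fin 2 → Ω) i := by
      ext i
      fin_cases i
      · simp [mul_div_cancel₀ _ h1]
      · simp
    by_contra hcon
    push Not at hcon
    have hle : Ideal.span (Set.range fun i => dehom K (f i)) ≤
        RingHom.ker (Polynomial.aeval (R := K) (σ 0 / σ 1)) := by
      rw [Ideal.span_le]
      rintro _ ⟨i, rfl⟩
      have h := hcon i
      rw [hσ', aeval_mul_of_isHomogeneous (hf.homogeneous i), ← aeval_dehom] at h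
      exact (mul_eq_zero.1 h).resolve_left (pow_ne_zero _ h1)
    rw [hf.span_dehom_eq_top, top_le_iff] at hle
    exact RingHom.ker_ne_top _ hle

/-- A point whose moving lines meet the generic point of the curve is the generic point. -/
theorem IsMuBasis.eq_mul_of_orthogonal [IsAlgClosed K] (h : IsMuBasis n μ f p q)
    (hf : IsProperParam n f) {τ : Ω} (hτ : Transcendental K τ) {σ : Fin 2 → Ω} (hσ : σ ≠ 0)
    (hp : ∑ i, aeval ![τ, 1] (f i) * aeval σ (p i) = 0)
    (hq : ∑ i, aeval ![τ, 1] (f i) * aeval σ (q i) = 0) : σ 0 = τ * σ 1 := by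
  obtain ⟨c, hc0, hc⟩ := h.cross_eq hf
  have hprop : ∀ i j, aeval ![τ, 1] (f i) * aeval σ (f j) =
      aeval ![τ, 1] (f j) * aeval σ (f i) := by
    intro i j
    have hij := mul_cross_eq_of_orthogonal hp hq i j
    have hw : ∀ i, cross (fun i => aeval σ (p i)) (fun i => aeval σ (q i)) i =
        algebraMap K Ω c * aeval σ (f i) := fun i => by
      rw [← aeval_C (R := K) (f := σ) c, ← map_mul, ← hc]
      exact (map_cross (aeval σ : MvPolynomial (Fin 2) K →ₐ[K] Ω).toRingHom p q i).symm
    have hcΩ : algebraMap K Ω c ≠ 0 := (map_ne_zero _).2 hc0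
    rw [hw, hw] at hij
    refine mul_left_cancel₀ hcΩ ?_
    linear_combination hij
  obtain ⟨j, hj⟩ := hf.exists_aeval_ne_zero hσ
  obtain ⟨j', hj'⟩ := hf.exists_aeval_ne_zero (σ := ![τ, 1])
    (fun h => one_ne_zero (congrFun h 1 : (1 : Ω) = 0))
  set l := aeval ![τ, 1] (f j) / aeval σ (f j) with hl
  have hyz : (fun i => aeval ![τ, 1] (f i)) = fun i => l * aeval σ (f i) := by
    ext1 i
    rw [hl, div_mul_eq_mul_div, ← hprop i j, mul_div_cancel_right₀ _ hj]
  obtain ⟨k, A, B, hA, hB, hAB0, hAB⟩ := hf.birational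
  have hσAB := congrArg (aeval σ) hAB
  have hτAB := congrArg (aeval ![τ, 1]) hAB
  simp only [map_mul, aeval_X, comp_aeval_apply, Matrix.cons_val_zero, Matrix.cons_val_one,
    mul_one] at hσAB hτAB
  have hA' : aeval (fun i => aeval ![τ, 1] (f i)) A = l ^ k * aeval (fun i => aeval σ (f i)) A := by
    rw [hyz, aeval_mul_of_isHomogeneous hA]
  have hB' : aeval (fun i => aeval ![τ, 1] (f i)) B = l ^ k * aeval (fun i => aeval σ (f i)) B := by
    rw [hyz, aeval_mul_of_isHomogeneous hB]
  -- Transcendence of `τ` makes a form vanishing at the generic point vanish identically along the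
  -- curve. The inverse map `(A : B)` is therefore defined there.
  have hinj : ∀ D : MvPolynomial (Fin 3) K, D.IsHomogeneous k →
      aeval (fun i => aeval ![τ, 1] (f i)) D = 0 → aeval f D = 0 := by
    intro D hD h0
    refine eq_zero_of_dehom_eq_zero (hD.aeval f hf.homogeneous) ?_
    rw [← comp_aeval_apply, ← aeval_dehom] at h0
    exact transcendental_iff.1 hτ _ h0
  have hB0 : aeval (fun i => aeval ![τ, 1] (f i)) B ≠ 0 := by
    intro h0
    rw [h0, zero_mul] at hτAB
    exact hAB0.elim (fun h => h (hinj A hA hτAB)) (fun h => h (hinj B hB h0))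
  refine mul_left_cancel₀ hB0 ?_
  rw [← mul_assoc, ← hτAB, hA', hB', mul_assoc, mul_assoc, hσAB]

theorem aeval_map_algebraMap_sum (g : Fin 3 → Polynomial K) (y : Fin 3 → Ω) (x : Ω) :
    (∑ i, Polynomial.C (y i) * (g i).map (algebraMap K Ω)).eval x =
      ∑ i, y i * Polynomial.aeval x (g i) := by
  simp [Polynomial.eval_finsetSum, Polynomial.eval_map_algebraMap]

/-- The moving lines of a `μ`-basis do not both meet the curve with multiplicity at the generic
point. -/
theorem IsMuBasis.not_derivative_orthogonal [IsAlgClosed K] [CharZero K]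
    (h : IsMuBasis n μ f p q) (hf : IsProperParam n f) (hn : n ≠ 0) {τ : Ω}
    (hτ : Transcendental K τ)
    (hp : ∑ i, aeval ![τ, 1] (f i) * Polynomial.aeval τ (dehom K (p i)).derivative = 0)
    (hq : ∑ i, aeval ![τ, 1] (f i) * Polynomial.aeval τ (dehom K (q i)).derivative = 0) :
    False := by
  -- By transcendence `∑ f i * r i' = 0` holds identically, so differentiating the syzygy leaves `∑
  -- f i' * r i = 0`.
  have hder : ∀ r : Fin 3 → MvPolynomial (Fin 2) K, ∑ i, f i * r i = 0 →
      ∑ i, aeval ![τ, 1] (f i) * Polynomial.aeval τ (dehom K (r i)).derivative = 0 →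
      ∑ i, (dehom K (f i)).derivative * dehom K (r i) = 0 := by
    intro r hr h0
    have h1 : ∑ i, dehom K (f i) * (dehom K (r i)).derivative = 0 := by
      refine transcendental_iff.1 hτ _ ?_
      simpa [aeval_dehom] using h0
    have h2 := congrArg (fun F => (dehom K F).derivative) hr
    simp only [map_sum, map_mul, map_zero, Polynomial.derivative_mul, Finset.sum_add_distrib,
      h1, add_zero] at h2
    exact h2
  obtain ⟨c, hc0, hc⟩ := h.cross_eq hf
  have hprop : ∀ i j, (dehom K (f i)).derivative * dehom K (f j) =
      (dehom K (f j)).derivative * dehom K (f i) := by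
    intro i j
    have hij := mul_cross_eq_of_orthogonal (hder p h.sum_mul_left hp)
      (hder q h.sum_mul_right hq) i j
    have hw : ∀ i, cross (fun i => dehom K (p i)) (fun i => dehom K (q i)) i =
        Polynomial.C c * dehom K (f i) := fun i => by
      have h1 := map_cross (dehom K).toRingHom p q i
      rw [hc] at h1
      refine h1.symm.trans ?_
      change dehom K (C c * f i) = _
      rw [C_mul', map_smul, Polynomial.smul_eq_C_mul]
    have hcK : (Polynomial.C c : Polynomial K) ≠ 0 := Polynomial.C_ne_zero.2 hc0
    rw [hw, hw] at hij
    refine mul_left_cancel₀ hcK ?_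
    linear_combination hij
  -- This `f i` keeps degree exactly `n > 0` after dehomogenization, yet it will divide its own
  -- derivative, so in characteristic `0` it must be constant.
  obtain ⟨i, hi⟩ := hf.exists_eval_ne_zero (x := ![1, 0])
    (fun h => one_ne_zero (congrFun h 0 : (1 : K) = 0))
  have hdvd : dehom K (f i) ∣ (dehom K (f i)).derivative :=
    dvd_of_forall_dvd_mul hf.isUnit_of_dvd_dehom fun j => ⟨_, by rw [hprop i j, mul_comm]⟩
  have hconst : (dehom K (f i)).natDegree = 0 := by
    by_contra hdeg
    have hlt := Polynomial.natDegree_derivative_lt hdeg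
    have h0 := Polynomial.eq_zero_of_dvd_of_natDegree_lt hdvd hlt
    exact hdeg (Polynomial.derivative_eq_zero.1 h0)
  have h1 := coeff_dehom_eq_aeval (hf.homogeneous i) K
  rw [aeval_eq_eval] at h1
  rw [Polynomial.coeff_eq_zero_of_natDegree_lt (by omega), map_zero] at h1
  exact hi h1.symm

section Generic

variable [IsAlgClosed K] (h : IsMuBasis n μ f p q) (hf : IsProperParam n f)
  {τ : Ω} (hτ : Transcendental K τ)
include h hf hτ

/-- The top coefficients are the values at `(1 : 0)`; their simultaneous vanishing would identify
this point with the generic point `(τ : 1)`. -/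
theorem IsMuBasis.not_coeff_eq_zero :
    ¬ ((dehom Ω (linForm p fun i => aeval ![τ, 1] (f i))).coeff μ = 0 ∧
      (dehom Ω (linForm q fun i => aeval ![τ, 1] (f i))).coeff (n - μ) = 0) := by
  rintro ⟨hp, hq⟩
  have key : ∀ (r : Fin 3 → MvPolynomial (Fin 2) K) (d : ℕ), (∀ i, (r i).IsHomogeneous d) →
      (dehom Ω (linForm r fun i => aeval ![τ, 1] (f i))).coeff d = 0 →
      ∑ i, aeval ![τ, 1] (f i) * aeval ![(1 : Ω), 0] (r i) = 0 := by
    intro r d hr h0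
    refine Eq.trans ?_ h0
    rw [dehom_linForm, Polynomial.finsetSum_coeff]
    refine Finset.sum_congr rfl fun i _ => ?_
    rw [Polynomial.coeff_C_mul, Polynomial.coeff_map, coeff_dehom_eq_aeval (hr i)]
  have h1 := h.eq_mul_of_orthogonal hf hτ (σ := ![1, 0])
    (fun h => one_ne_zero (congrFun h 0 : (1 : Ω) = 0)) (key p _ h.homogeneous_left hp)
    (key q _ h.homogeneous_right hq)
  simp at h1

/-- A common root must be `τ`, where the linear factor vanishes as well. Both moving lines then have
vanishing derivative at `τ`. -/
theorem IsMuBasis.not_common_root [CharZero K] (hn : n ≠ 0) {P Q : Polynomial Ω}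
    (hP : linPoly 1 τ * P = dehom Ω (linForm p fun i => aeval ![τ, 1] (f i)))
    (hQ : linPoly 1 τ * Q = dehom Ω (linForm q fun i => aeval ![τ, 1] (f i))) (x : Ω) :
    ¬ (P.eval x = 0 ∧ Q.eval x = 0) := by
  rintro ⟨hPx, hQx⟩
  rw [dehom_linForm] at hP hQ
  have key : ∀ (r : Fin 3 → MvPolynomial (Fin 2) K) (T : Polynomial Ω),
      linPoly 1 τ * T = ∑ i, Polynomial.C (aeval ![τ, 1] (f i)) *
        (dehom K (r i)).map (algebraMap K Ω) → T.eval x = 0 →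
      ∑ i, aeval ![τ, 1] (f i) * aeval ![x, 1] (r i) = 0 := by
    intro r T hT hTx
    have h0 := congrArg (Polynomial.eval x) hT
    rw [Polynomial.eval_mul, hTx, mul_zero, aeval_map_algebraMap_sum] at h0
    simpa [aeval_dehom] using h0.symm
  have hx := h.eq_mul_of_orthogonal hf hτ (σ := ![x, 1])
    (fun h => one_ne_zero (congrFun h 1 : (1 : Ω) = 0)) (key p P hP hPx) (key q Q hQ hQx)
  simp only [Matrix.cons_val_zero, Matrix.cons_val_one, mul_one] at hx
  subst hx
  have key' : ∀ (r : Fin 3 → MvPolynomial (Fin 2) K) (T : Polynomial Ω),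
      linPoly 1 x * T = ∑ i, Polynomial.C (aeval ![x, 1] (f i)) *
        (dehom K (r i)).map (algebraMap K Ω) → T.eval x = 0 →
      ∑ i, aeval ![x, 1] (f i) * Polynomial.aeval x (dehom K (r i)).derivative = 0 := by
    intro r T hT hTx
    have h0 := congrArg (fun F => F.derivative.eval x) hT
    simp only [Polynomial.derivative_mul, Polynomial.eval_add, Polynomial.eval_mul, hTx,
      Polynomial.derivative_sum, Polynomial.derivative_C, zero_mul, zero_add,
      Polynomial.derivative_map, mul_zero, aeval_map_algebraMap_sum] at h0
    rw [← h0]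
    simp [linPoly]
  exact h.not_derivative_orthogonal hf hn hτ (key' p P hP hPx) (key' q Q hQ hQx)

end Generic

/-! ### Submaximal minors with a common linear factor, and gcds of minors. -/

section Linear

variable {R : Type*} [CommRing R]

theorem natDegree_le_of_linPoly_mul [IsDomain R] {u t : R} (hu : u ≠ 0) {g : Polynomial R} {m : ℕ}
    (h : (linPoly u t * g).natDegree ≤ m) : g.natDegree ≤ m - 1 := by
  by_cases hg : g = 0
  · simp [hg]
  have h1 : (linPoly u t).natDegree = 1 := by
    rw [linPoly, Polynomial.natDegree_sub_C, Polynomial.natDegree_C_mul_X u hu]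
  have h0 : linPoly u t ≠ 0 := by
    intro h0
    rw [h0, Polynomial.natDegree_zero] at h1
    exact zero_ne_one h1
  rw [Polynomial.natDegree_mul h0 hg, h1] at h
  omega

theorem mul_coeff_mul_mem {I : Ideal R} {w : R} {g : Polynomial R} (h : ∀ k, w * g.coeff k ∈ I)
    (L : Polynomial R) (k : ℕ) : w * (L * g).coeff k ∈ I := by
  rw [Polynomial.coeff_mul, Finset.mul_sum]
  refine Ideal.sum_mem _ fun x _ => ?_
  rw [mul_left_comm]
  exact Ideal.mul_mem_left _ _ (h _)

theorem mul_coeff_mem_of_sylvesterKernel {I : Ideal R} {w : R} {f g : Polynomial R} {a b : ℕ}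
    (hf : f.natDegree ≤ a) (hg : g.natDegree ≤ b)
    (h : ∀ j, w * sylvesterKernel f g a b j ∈ I) (k : ℕ) :
    w * f.coeff k ∈ I ∧ w * g.coeff k ∈ I := by
  constructor
  · by_cases hk : k < a + 1
    · have := h (Fin.castAdd _ ⟨k, hk⟩)
      rw [sylvesterKernel, Fin.addCases_left, mul_neg, neg_mem_iff] at this
      exact this
    · rw [Polynomial.coeff_eq_zero_of_natDegree_lt (by omega), mul_zero]
      exact I.zero_mem
  · by_cases hk : k < b + 1
    · have := h (Fin.natAdd _ ⟨k, hk⟩)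
      rw [sylvesterKernel, Fin.addCases_right] at this
      exact this
    · rw [Polynomial.coeff_eq_zero_of_natDegree_lt (by omega), mul_zero]
      exact I.zero_mem

/-- The submaximal minors of a Sylvester matrix with the common factor `u X - t`. -/
theorem minors_sylvester_linPoly {f g : Polynomial R} {m e : ℕ} (hm : m ≠ 0) (he : e ≠ 0)
    (hf : f.natDegree ≤ m - 1) (hg : g.natDegree ≤ e - 1) (u t : R) :
    (Polynomial.sylvester (linPoly u t * f) (linPoly u t * g) m e).det = 0 ∧
    minorIdeal (Polynomial.sylvester (linPoly u t * f) (linPoly u t * g) m e) (m + e - 1) ≤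
      Ideal.span {Polynomial.resultant f g (m - 1) (e - 1)} ∧
    ∀ w ∈ ({u ^ (m + e - 1), (-t) ^ (m + e - 1)} : Set R), ∀ k,
      w * Polynomial.resultant f g (m - 1) (e - 1) * (linPoly u t * f).coeff k ∈
        minorIdeal (Polynomial.sylvester (linPoly u t * f) (linPoly u t * g) m e) (m + e - 1) ∧
      w * Polynomial.resultant f g (m - 1) (e - 1) * (linPoly u t * g).coeff k ∈
        minorIdeal (Polynomial.sylvester (linPoly u t * f) (linPoly u t * g) m e) (m + e - 1) := by
  obtain ⟨a, rfl⟩ := Nat.exists_eq_succ_of_ne_zero hm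
  obtain ⟨b, rfl⟩ := Nat.exists_eq_succ_of_ne_zero he
  refine ⟨det_sylvester_linPoly_mul hf hg u t, minorIdeal_sylvester_linPoly_le hf hg u t, ?_⟩
  intro w hw k
  have hker : ∀ j, w * Polynomial.resultant f g a b * sylvesterKernel f g a b j ∈
      minorIdeal (Polynomial.sylvester (linPoly u t * f) (linPoly u t * g) (a + 1) (b + 1))
        (a + 1 + b) := by
    intro j
    rw [mul_assoc]
    rcases hw with rfl | rfl
    · exact pow_mul_resultant_mem_minorIdeal hf hg u t j
    · exact neg_pow_mul_resultant_mem_minorIdeal hf hg u t j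
  have h := mul_coeff_mem_of_sylvesterKernel hf hg hker
  exact ⟨mul_coeff_mul_mem (fun k => (h k).1) _ k, mul_coeff_mul_mem (fun k => (h k).2) _ k⟩

theorem IsGCDOfMinors.isGCD_minorIdeal {N : ℕ} {A : Matrix (Fin N) (Fin N) R} {k : ℕ} {D : R}
    (h : IsGCDOfMinors A k D) :
    minorIdeal A k ≤ Ideal.span {D} ∧ ∀ E, minorIdeal A k ≤ Ideal.span {E} → E ∣ D := by
  constructor
  · rw [minorIdeal_le_iff]
    intro r c
    by_cases hr : Function.Injective r
    · by_cases hc : Function.Injective c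
      · exact Ideal.mem_span_singleton.2 (h.1 ⟨r, hr⟩ ⟨c, hc⟩)
      · simp only [Function.Injective, not_forall] at hc
        obtain ⟨x, y, hxy, hne⟩ := hc
        rw [Matrix.det_zero_of_column_eq hne fun i => by simp [Matrix.submatrix_apply, hxy]]
        exact Ideal.zero_mem _
    · simp only [Function.Injective, not_forall] at hr
      obtain ⟨x, y, hxy, hne⟩ := hr
      rw [Matrix.det_zero_of_row_eq hne (by ext; simp [Matrix.submatrix_apply, hxy])]
      exact Ideal.zero_mem _
  · intro E hE
    refine h.2 E fun r c => Ideal.mem_span_singleton.1 (hE ?_)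
    exact det_submatrix_mem_minorIdeal A r c

end Linear

/-! ### Specialization of the moving lines and nonvanishing of `Δ`. -/

variable {K : Type*} [Field K] {n μ : ℕ} {f p q : Fin 3 → MvPolynomial (Fin 2) K}

theorem map_dehom_linForm {R S : Type*} [CommRing R] [Algebra K R] [CommRing S] [Algebra K S]
    (φ : R →ₐ[K] S) (p : Fin 3 → MvPolynomial (Fin 2) K) (y : Fin 3 → R) :
    (dehom R (linForm p y)).map (φ : R →+* S) = dehom S (linForm p fun i => φ (y i)) := by
  rw [dehom_linForm, dehom_linForm, Polynomial.map_sum]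
  refine Finset.sum_congr rfl fun i _ => ?_
  rw [Polynomial.map_mul, Polynomial.map_C, Polynomial.map_map, AlgHom.comp_algebraMap]
  rfl

theorem dehom_phiForm {d : ℕ} (hp : ∀ i, (p i).IsHomogeneous d) (hpf : ∑ i, f i * p i = 0) :
    dehom _ (phiForm f p) = linPoly (X 1) (X 0) * dehom _ (divDiag (phiForm f p)) := by
  conv_lhs => rw [← diag_mul_divDiag (diag_dvd_phiForm hp hpf), map_mul, dehom_diag]

theorem natDegree_dehom_divDiag_le {d : ℕ} (hp : ∀ i, (p i).IsHomogeneous d)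
    (hpf : ∑ i, f i * p i = 0) : (dehom _ (divDiag (phiForm f p))).natDegree ≤ d - 1 := by
  refine natDegree_le_of_linPoly_mul (u := X 1) (t := X 0) (X_ne_zero _) ?_
  rw [← dehom_phiForm hp hpf]
  exact natDegree_dehom_le (isHomogeneous_linForm hp f)

theorem linPoly_mul_map_dehom_divDiag {d : ℕ} (hp : ∀ i, (p i).IsHomogeneous d)
    (hpf : ∑ i, f i * p i = 0) {Ω : Type*} [Field Ω] [Algebra K Ω] (τ : Ω) :
    linPoly 1 τ * (dehom _ (divDiag (phiForm f p))).map
      (aeval ![τ, 1] : MvPolynomial (Fin 2) K →ₐ[K] Ω).toRingHom =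
      dehom Ω (linForm p fun i => aeval ![τ, 1] (f i)) := by
  have h := map_dehom_linForm (aeval ![τ, 1] : MvPolynomial (Fin 2) K →ₐ[K] Ω) p f
  rw [← phiForm, dehom_phiForm hp hpf, Polynomial.map_mul] at h
  rw [← h]
  congr 1
  simp [linPoly]

theorem exists_transcendental_algebraicClosure_ratFunc (K : Type*) [Field K] :
    ∃ τ : AlgebraicClosure (RatFunc K), Transcendental K τ :=
  ⟨algebraMap (RatFunc K) _ (algebraMap (Polynomial K) _ Polynomial.X),
    (transcendental_algebraMap_iff (algebraMap (RatFunc K) _).injective).2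
      ((transcendental_algebraMap_iff (RatFunc.algebraMap_injective K)).2
        (Polynomial.transcendental_X K))⟩

section

variable [IsAlgClosed K] [CharZero K] (h : IsMuBasis n μ f p q) (hf : IsProperParam n f)
include h hf

/-- If `μ = 0`, then `p_φ` is the syzygy relation itself, hence zero. The quotient of `q_φ` then has
degree exactly `n - 1 > 0`, and any root of it is a forbidden common root. -/
theorem IsMuBasis.ne_zero (hn : 3 ≤ n) : μ ≠ 0 := by
  rintro rfl
  let Ω := AlgebraicClosure (RatFunc K)
  obtain ⟨τ, hτ⟩ := exists_transcendental_algebraicClosure_ratFunc K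
  have hP := linPoly_mul_map_dehom_divDiag h.homogeneous_left h.sum_mul_left τ
  have hQ := linPoly_mul_map_dehom_divDiag h.homogeneous_right h.sum_mul_right τ
  have hQdeg : ((dehom _ (divDiag (phiForm f q))).map
      (aeval ![τ, 1] : MvPolynomial (Fin 2) K →ₐ[K] Ω).toRingHom).natDegree ≤ n - 1 :=
    Polynomial.natDegree_map_le.trans
      (natDegree_dehom_divDiag_le h.homogeneous_right h.sum_mul_right)
  have hP0 : dehom Ω (linForm p fun i => aeval ![τ, 1] (f i)) = 0 := by
    have h0 : ∀ i, p i = C ((p i).coeff 0) := fun i =>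
      totalDegree_eq_zero_iff_eq_C.1 (Nat.le_zero.1 (h.homogeneous_left i).totalDegree_le)
    have h1 := congrArg (aeval ![τ, 1]) h.sum_mul_left
    have hd : ∀ i, dehom K (p i) = Polynomial.C ((p i).coeff 0) := fun i => by
      conv_lhs => rw [h0 i, ← algebraMap_eq, AlgHom.commutes, Polynomial.algebraMap_eq]
    rw [dehom_linForm]
    simp only [hd, Polynomial.map_C, ← Polynomial.C_mul, ← map_sum]
    rw [Polynomial.C_eq_zero]
    rw [map_sum, map_zero] at h1
    rw [← h1]
    refine Finset.sum_congr rfl fun i _ => ?_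
    conv_rhs => rw [h0 i, map_mul, aeval_C]
  have hlead := h.not_coeff_eq_zero hf hτ
  have hroot := h.not_common_root hf hτ (by omega) hP hQ
  set P' := (dehom _ (divDiag (phiForm f p))).map
      (aeval ![τ, 1] : MvPolynomial (Fin 2) K →ₐ[K] Ω).toRingHom
  set Q' := (dehom _ (divDiag (phiForm f q))).map
      (aeval ![τ, 1] : MvPolynomial (Fin 2) K →ₐ[K] Ω).toRingHom
  have hQ' : Q'.coeff (n - 1) ≠ 0 := by
    intro h0
    refine hlead ⟨by rw [hP0, Polynomial.coeff_zero], ?_⟩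
    rw [← hQ, show n - 0 = n - 1 + 1 by omega, coeff_linPoly_mul _ _ hQdeg, h0, mul_zero]
  have hP' : P' = 0 := by
    rw [hP0] at hP
    refine (mul_eq_zero.1 hP).resolve_left fun h0 => ?_
    have := congrArg (fun F => Polynomial.coeff F 1) h0
    simp [linPoly] at this
  obtain ⟨x, hx⟩ := IsAlgClosed.exists_root Q' (by
    intro hd
    have h1 : Q'.natDegree = 0 := Polynomial.natDegree_eq_of_degree_eq_some hd
    have h2 := Polynomial.natDegree_eq_of_le_of_coeff_ne_zero hQdeg hQ'
    omega)
  exact hroot x ⟨by rw [hP', Polynomial.eval_zero], hx⟩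

theorem IsMuBasis.dehom_Delta_ne_zero (hn : 3 ≤ n) : dehom K (Delta n μ f p q) ≠ 0 := by
  have hμ := h.ne_zero hf hn
  have hμn := h.two_mul_le
  let Ω := AlgebraicClosure (RatFunc K)
  obtain ⟨τ, hτ⟩ := exists_transcendental_algebraicClosure_ratFunc K
  have hP := linPoly_mul_map_dehom_divDiag h.homogeneous_left h.sum_mul_left τ
  have hQ := linPoly_mul_map_dehom_divDiag h.homogeneous_right h.sum_mul_right τ
  have hPdeg : ((dehom _ (divDiag (phiForm f p))).map
      (aeval ![τ, 1] : MvPolynomial (Fin 2) K →ₐ[K] Ω).toRingHom).natDegree ≤ μ - 1 :=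
    Polynomial.natDegree_map_le.trans
      (natDegree_dehom_divDiag_le h.homogeneous_left h.sum_mul_left)
  have hQdeg : ((dehom _ (divDiag (phiForm f q))).map
      (aeval ![τ, 1] : MvPolynomial (Fin 2) K →ₐ[K] Ω).toRingHom).natDegree ≤ n - μ - 1 :=
    Polynomial.natDegree_map_le.trans
      (natDegree_dehom_divDiag_le h.homogeneous_right h.sum_mul_right)
  have hlead := h.not_coeff_eq_zero hf hτ
  rw [← hP, ← hQ, show μ = μ - 1 + 1 by omega, coeff_linPoly_mul _ _ hPdeg,
    show μ - 1 + 1 = μ by omega, show n - μ = n - μ - 1 + 1 by omega,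
    coeff_linPoly_mul _ _ hQdeg, one_mul, one_mul] at hlead
  have hres := resultant_ne_zero_of_no_common_root hPdeg hQdeg hlead
    (h.not_common_root hf hτ (by omega) hP hQ)
  rw [Polynomial.resultant_map_map] at hres
  intro h0
  apply hres
  change aeval ![τ, 1] (Delta n μ f p q) = 0
  rw [← aeval_dehom, h0, map_zero]

end

theorem sylvesterPhi_map {D : Type*} [CommRing D] [Algebra K D]
    (φ : MvPolynomial (Fin 2) K →ₐ[K] D) : (sylvesterPhi n μ f p q).map φ =
      Polynomial.sylvester (dehom D (linForm p fun i => φ (f i)))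
        (dehom D (linForm q fun i => φ (f i))) μ (n - μ) := by
  rw [← map_dehom_linForm, ← map_dehom_linForm, Polynomial.sylvester_map_map]
  rfl

/-- At a point of the parameter line the Sylvester matrix has rank at least `μ`. -/
theorem IsMuBasis.exists_minor_ne_zero (h : IsMuBasis n μ f p q) (hf : IsProperParam n f)
    (hn : n ≠ 0) {D : Type*} [CommRing D] [IsDomain D] [Algebra K D]
    (φ : MvPolynomial (Fin 2) K →ₐ[K] D) (hφ : ∃ i, φ (f i) ≠ 0) :
    ∃ r c : Fin μ → Fin (μ + (n - μ)), φ ((sylvesterPhi n μ f p q).submatrix r c).det ≠ 0 := by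
  have hμn := h.two_mul_le
  obtain ⟨r, c, hrc⟩ := exists_det_submatrix_sylvester_ne_zero (m := μ) (e := n - μ) (by omega)
    (natDegree_dehom_le (isHomogeneous_linForm h.homogeneous_left fun i => φ (f i)))
    (natDegree_dehom_le (isHomogeneous_linForm h.homogeneous_right fun i => φ (f i))) (by
      by_contra hcon
      push Not at hcon
      obtain ⟨i, hi⟩ := hφ
      apply hi
      have := h.mul_mem_of_coeff_mem hf hn (⊥ : Ideal D) 1 (fun i => φ (f i))
        (by simp [hcon.1]) (by simp [hcon.2]) i
      simpa using this)
  refine ⟨r, c, ?_⟩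
  rw [← sylvesterPhi_map] at hrc
  rw [AlgHom.map_det]
  exact hrc

/-! ### The subresultant and the ideals of minors of `S(t,u)`. -/

section

variable {K : Type*} [Field K] {n μ : ℕ} {f p q : Fin 3 → MvPolynomial (Fin 2) K}

theorem IsMuBasis.aeval_SRes (h : IsMuBasis n μ f p q) (hμ : μ ≠ 0) :
    aeval f (SRes n μ p q) =
      C ((-1) ^ ((μ - 1) * (n - μ - 1))) * X 1 ^ (n - 2) * Delta n μ f p q := by
  have hμn := h.two_mul_le
  have hmap : ∀ r : Fin 3 → MvPolynomial (Fin 2) K,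
      (dehom _ (linForm r (X : Fin 3 → MvPolynomial (Fin 3) K))).map
        (aeval f : MvPolynomial (Fin 3) K →ₐ[K] MvPolynomial (Fin 2) K).toRingHom =
      dehom _ (phiForm f r) := fun r => by
    have h := map_dehom_linForm (aeval f : MvPolynomial (Fin 3) K →ₐ[K] MvPolynomial (Fin 2) K)
      r X
    simp only [aeval_X] at h
    exact h
  have hsub := subresultant_linPoly_mul
    (natDegree_dehom_divDiag_le h.homogeneous_left h.sum_mul_left)
    (natDegree_dehom_divDiag_le h.homogeneous_right h.sum_mul_right)
    (X 1 : MvPolynomial (Fin 2) K) (X 0)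
  rw [← dehom_phiForm h.homogeneous_left h.sum_mul_left,
    ← dehom_phiForm h.homogeneous_right h.sum_mul_right,
    show μ - 1 + (n - μ - 1) = n - 2 by omega] at hsub
  rw [C_pow, C_neg, C_1]
  refine Eq.trans ?_ hsub
  rw [SRes, formSRes, AlgHom.map_det]
  congr 1
  ext1 i j
  rw [AlgHom.mapMatrix_apply, Matrix.map_apply, Matrix.of_apply, Matrix.of_apply]
  have hc : ∀ (r : Fin 3 → MvPolynomial (Fin 2) K) (k l : ℕ), aeval f ((Polynomial.X ^ k *
      dehom _ (linForm r (X : Fin 3 → MvPolynomial (Fin 3) K))).coeff l) =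
      (Polynomial.X ^ k * dehom _ (phiForm f r)).coeff l := fun r k l => by
    rw [← hmap, ← Polynomial.map_X (aeval f : MvPolynomial (Fin 3) K →ₐ[K] _).toRingHom,
      ← Polynomial.map_pow, ← Polynomial.map_mul, Polynomial.coeff_map]
    rfl
  induction j using Fin.addCases with
  | left j => simp only [Fin.addCases_left, hc]
  | right j => simp only [Fin.addCases_right, hc]

theorem IsMuBasis.minorIdeal_sylvesterPhi (h : IsMuBasis n μ f p q) (hf : IsProperParam n f)
    (hn : n ≠ 0) (hμ : μ ≠ 0) :
    (sylvesterPhi n μ f p q).det = 0 ∧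
    minorIdeal (sylvesterPhi n μ f p q) (n - 1) ≤ Ideal.span {Delta n μ f p q} ∧
    ∀ i, (X 1 ^ (n - 1) * Delta n μ f p q) * f i ∈ minorIdeal (sylvesterPhi n μ f p q) (n - 1) ∧
      ((-X 0) ^ (n - 1) * Delta n μ f p q) * f i ∈
        minorIdeal (sylvesterPhi n μ f p q) (n - 1) := by
  have hμn := h.two_mul_le
  have hmin := minors_sylvester_linPoly hμ (by omega : n - μ ≠ 0)
    (natDegree_dehom_divDiag_le h.homogeneous_left h.sum_mul_left)
    (natDegree_dehom_divDiag_le h.homogeneous_right h.sum_mul_right)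
    (X 1 : MvPolynomial (Fin 2) K) (X 0)
  rw [← dehom_phiForm h.homogeneous_left h.sum_mul_left,
    ← dehom_phiForm h.homogeneous_right h.sum_mul_right,
    show μ + (n - μ) - 1 = n - 1 by omega] at hmin
  obtain ⟨h1, h2, h3⟩ := hmin
  refine ⟨h1, h2, fun i => ⟨?_, ?_⟩⟩
  · exact h.mul_mem_of_coeff_mem hf hn _ _ f (fun k => (h3 _ (Or.inl rfl) k).1)
      (fun k => (h3 _ (Or.inl rfl) k).2) i
  · exact h.mul_mem_of_coeff_mem hf hn _ _ f (fun k => (h3 _ (Or.inr rfl) k).1)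
      (fun k => (h3 _ (Or.inr rfl) k).2) i

/-- A prime factor `π` of `E` would kill every minor of size `μ` in the domain `K[t,u]/(π)`,
although the coprime `f i` do not all vanish there. -/
theorem IsMuBasis.isUnit_of_minorIdeal_le (h : IsMuBasis n μ f p q) (hf : IsProperParam n f)
    (hn : n ≠ 0) {E : MvPolynomial (Fin 2) K}
    (hE : minorIdeal (sylvesterPhi n μ f p q) μ ≤ Ideal.span {E}) : IsUnit E := by
  by_contra hu
  obtain ⟨π, hπ, hπE⟩ : ∃ π, Prime π ∧ π ∣ E := by
    by_cases hE0 : E = 0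
    · exact ⟨X 0, X_prime, hE0 ▸ dvd_zero _⟩
    · obtain ⟨π, hπ, hπE⟩ := WfDvdMonoid.exists_irreducible_factor hu hE0
      exact ⟨π, hπ.prime, hπE⟩
  have : (Ideal.span {π}).IsPrime := (Ideal.span_singleton_prime hπ.ne_zero).2 hπ
  have hmk : ∀ x, Ideal.Quotient.mkₐ K (Ideal.span {π}) x = 0 ↔ π ∣ x := fun x => by
    rw [Ideal.Quotient.mkₐ_eq_mk, Ideal.Quotient.eq_zero_iff_mem, Ideal.mem_span_singleton]
  obtain ⟨r, c, hrc⟩ := h.exists_minor_ne_zero hf hn (Ideal.Quotient.mkₐ K (Ideal.span {π})) (by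
    by_contra hcon
    push Not at hcon
    exact hπ.not_isUnit (hf.gcd_eq_one π fun i => (hmk _).1 (hcon i)))
  exact hrc ((hmk _).2 (hπE.trans (Ideal.mem_span_singleton.1
    (hE (det_submatrix_mem_minorIdeal _ r c)))))

variable [IsAlgClosed K]

theorem IsMuBasis.minorIdeal_map_eq_top (h : IsMuBasis n μ f p q) (hf : IsProperParam n f)
    (hn : n ≠ 0) : minorIdeal ((sylvesterPhi n μ f p q).map (dehom K)) μ = ⊤ := by
  by_contra hne
  obtain ⟨m, hm, hle⟩ := Ideal.exists_le_maximal _ hne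
  have hmk : ∀ x, Ideal.Quotient.mkₐ K m x = 0 ↔ x ∈ m := fun x => by
    rw [Ideal.Quotient.mkₐ_eq_mk, Ideal.Quotient.eq_zero_iff_mem]
  obtain ⟨r, c, hrc⟩ := h.exists_minor_ne_zero hf hn ((Ideal.Quotient.mkₐ K m).comp (dehom K)) (by
    by_contra hcon
    push Not at hcon
    refine hm.ne_top (top_le_iff.1 (hf.span_dehom_eq_top.ge.trans ?_))
    rw [Ideal.span_le]
    rintro _ ⟨i, rfl⟩
    exact (hmk _).1 (hcon i))
  apply hrc
  rw [AlgHom.comp_apply, hmk, AlgHom.map_det]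
  exact hle (det_submatrix_mem_minorIdeal _ r c)

theorem IsMuBasis.minorIdeal_map_eq_span (h : IsMuBasis n μ f p q) (hf : IsProperParam n f)
    (hn : n ≠ 0) (hμ : μ ≠ 0) : minorIdeal ((sylvesterPhi n μ f p q).map (dehom K)) (n - 1) =
      Ideal.span {dehom K (Delta n μ f p q)} := by
  obtain ⟨-, h2, h3⟩ := h.minorIdeal_sylvesterPhi hf hn hμ
  have hmap := minorIdeal_map (sylvesterPhi n μ f p q)
    (dehom K : MvPolynomial (Fin 2) K →+* Polynomial K) (n - 1)
  have hmap : minorIdeal ((sylvesterPhi n μ f p q).map (dehom K)) (n - 1) =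
      (minorIdeal (sylvesterPhi n μ f p q) (n - 1)).map
        (dehom K : MvPolynomial (Fin 2) K →+* Polynomial K) := hmap
  rw [hmap]
  apply le_antisymm
  · refine (Ideal.map_mono h2).trans ?_
    rw [Ideal.map_span, Set.image_singleton]
    rfl
  · rw [Ideal.span_singleton_le_iff_mem]
    set J := (minorIdeal (sylvesterPhi n μ f p q) (n - 1)).map
        (dehom K : MvPolynomial (Fin 2) K →+* Polynomial K)
    have hle : Ideal.span (Set.range fun i => dehom K (f i)) ≤
        Submodule.comap (LinearMap.mulLeft (Polynomial K) (dehom K (Delta n μ f p q))) J := by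
      rw [Ideal.span_le]
      rintro _ ⟨i, rfl⟩
      have h4 := Ideal.mem_map_of_mem
        (dehom K : MvPolynomial (Fin 2) K →+* Polynomial K) (h3 i).1
      have hX : dehom K (X 1) = 1 := aeval_X _ _
      rw [RingHom.coe_coe, map_mul, map_mul, map_pow, hX, one_pow, one_mul] at h4
      exact h4
    rw [hf.span_dehom_eq_top] at hle
    have := hle (Submodule.mem_top (x := 1))
    simpa using this

end

/-! ### Singular factors. -/

section

variable {K : Type*} [Field K] {n μ : ℕ}
  {f p q : Fin 3 → MvPolynomial (Fin 2) K} {d : ℕ → MvPolynomial (Fin 2) K}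

theorem IsSingularFactors.isUnit (hd : IsSingularFactors n μ f p q d) (h : IsMuBasis n μ f p q)
    (hf : IsProperParam n f) (hn : n ≠ 0) {k : ℕ} (hk : n - μ < k) (hkn : k ≤ n) :
    IsUnit (d k) := by
  have hμn := h.two_mul_le
  have hgcd := hd.isGCD (n - μ + 1) (Finset.mem_Icc.2 ⟨by omega, by omega⟩)
  rw [show n + 1 - (n - μ + 1) = μ by omega] at hgcd
  have hu := h.isUnit_of_minorIdeal_le hf hn hgcd.isGCD_minorIdeal.1
  refine isUnit_of_dvd_unit ?_ hu
  exact (dvd_pow_self (d k) (by omega)).trans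
    (Finset.dvd_prod_of_mem _ (Finset.mem_Icc.2 ⟨hk, hkn⟩))

theorem isUnit_of_dvd_X_pow {g : MvPolynomial (Fin 2) K} {m : ℕ} (h1 : g ∣ X 1 ^ m)
    (h0 : g ∣ (-X 0) ^ m) : IsUnit g := by
  have hrel : IsRelPrime (X 1 : MvPolynomial (Fin 2) K) (-X 0) := by
    rw [IsRelPrime.neg_right_iff, X_prime.irreducible.isRelPrime_iff_not_dvd, X_dvd_X]
    simp
  exact (hrel.pow (m := m) (n := m)) h1 h0

theorem IsSingularFactors.associated_Delta (hd : IsSingularFactors n μ f p q d)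
    (h : IsMuBasis n μ f p q) (hf : IsProperParam n f) (hn : 3 ≤ n) (hμ : μ ≠ 0) :
    Associated (Delta n μ f p q) (∏ k ∈ Finset.Icc 2 (n - μ), d k ^ (k - 1)) := by
  have hn0 : n ≠ 0 := by omega
  obtain ⟨-, h2, h3⟩ := h.minorIdeal_sylvesterPhi hf hn0 hμ
  have hgcd := hd.isGCD 2 (Finset.mem_Icc.2 ⟨by omega, by omega⟩)
  rw [show n + 1 - 2 = n - 1 by omega] at hgcd
  obtain ⟨hle, hdvd⟩ := hgcd.isGCD_minorIdeal
  have hall : Associated (Delta n μ f p q) (∏ k ∈ Finset.Icc 2 n, d k ^ (k + 1 - 2)) := by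
    refine associated_of_dvd_dvd (hdvd _ h2) ?_
    have hX1 := dvd_of_forall_dvd_mul hf.gcd_eq_one fun i =>
      Ideal.mem_span_singleton.1 (hle (h3 i).1)
    have hX0 := dvd_of_forall_dvd_mul hf.gcd_eq_one fun i =>
      Ideal.mem_span_singleton.1 (hle (h3 i).2)
    -- The gcd divides `Δ` times `u ^ (n - 1)` and `Δ` times `(-t) ^ (n - 1)`; these powers are
    -- coprime, so it divides `Δ`.
    refine dvd_of_forall_dvd_mul (f := ![X 1 ^ (n - 1), (-X 0) ^ (n - 1)])
      (fun g hg => isUnit_of_dvd_X_pow (hg 0) (hg 1)) fun i => ?_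
    rw [mul_comm]
    fin_cases i
    · exact hX1
    · exact hX0
  refine hall.trans ?_
  have hsub : Finset.Icc 2 (n - μ) ⊆ Finset.Icc 2 n := Finset.Icc_subset_Icc_right (by omega)
  rw [← Finset.prod_sdiff hsub]
  refine associated_unit_mul_left _ _ ?_
  rw [IsUnit.prod_iff]
  intro k hk
  simp only [Finset.mem_sdiff, Finset.mem_Icc] at hk
  exact (hd.isUnit h hf hn0 (by omega) (by omega)).pow _

theorem exists_C_of_isUnit {g : MvPolynomial (Fin 2) K} (hg : IsUnit g) :
    ∃ γ : K, γ ≠ 0 ∧ g = C γ := by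
  obtain ⟨γ, hγ, h⟩ := isUnit_iff_eq_C_of_isReduced.1 hg
  exact ⟨γ, hγ.ne_zero, h⟩

end

end PlaneCurve

theorem mainTheorem9 {K : Type*} [Field K] [IsAlgClosed K] [CharZero K]
    (n μ : ℕ) (hn : 3 ≤ n) (f p q : Fin 3 → MvPolynomial (Fin 2) K)
    (hf : PlaneCurve.IsProperParam n f) (hpq : PlaneCurve.IsMuBasis n μ f p q) :
    -- `su - tv` divides both forms, so that `Δ` is the resultant of the true quotients
    PlaneCurve.diag K * PlaneCurve.divDiag (PlaneCurve.phiForm f p) = PlaneCurve.phiForm f p ∧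
    PlaneCurve.diag K * PlaneCurve.divDiag (PlaneCurve.phiForm f q) = PlaneCurve.phiForm f q ∧
    -- `Δ` is, up to the factor `u ^ (n - 2)`, the first principal subresultant along the curve
    (∃ γ : K, γ ≠ 0 ∧ MvPolynomial.aeval f (PlaneCurve.SRes n μ p q) =
      MvPolynomial.C γ * MvPolynomial.X 1 ^ (n - 2) * PlaneCurve.Delta n μ f p q) ∧
    -- the Fitting ideals of `M`
    PlaneCurve.fittingIdeal (Polynomial K) (PlaneCurve.sylvesterCoker n μ f p q) 0 = ⊥ ∧
    PlaneCurve.fittingIdeal (Polynomial K) (PlaneCurve.sylvesterCoker n μ f p q) 1 =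
      Ideal.span {PlaneCurve.dehom K (PlaneCurve.Delta n μ f p q)} ∧
    IsLeast {r : ℕ | PlaneCurve.fittingIdeal (Polynomial K)
      (PlaneCurve.sylvesterCoker n μ f p q) r ≠ ⊥} 1 ∧
    (∀ l : ℕ, n - μ < l → PlaneCurve.fittingIdeal (Polynomial K)
      (PlaneCurve.sylvesterCoker n μ f p q) l = ⊤) ∧
    -- the singular factors
    (∀ d : ℕ → MvPolynomial (Fin 2) K, PlaneCurve.IsSingularFactors n μ f p q d →
      (∀ k : ℕ, n - μ < k → k ≤ n → ∃ γ : K, γ ≠ 0 ∧ d k = MvPolynomial.C γ) ∧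
      ∃ γ : K, γ ≠ 0 ∧ PlaneCurve.Delta n μ f p q =
        MvPolynomial.C γ * ∏ k ∈ Finset.Icc 2 (n - μ), d k ^ (k - 1)) := by

  have hμ := hpq.ne_zero hf hn
  have hμn := hpq.two_mul_le
  have hn0 : n ≠ 0 := by omega
  have hcoker : ∀ l, PlaneCurve.fittingIdeal (Polynomial K)
      (PlaneCurve.sylvesterCoker n μ f p q) l = PlaneCurve.minorIdeal
        ((PlaneCurve.sylvesterPhi n μ f p q).map (PlaneCurve.dehom K)) (μ + (n - μ) - l) :=
    fun l => PlaneCurve.fittingIdeal_coker _ l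
  have hF0 : PlaneCurve.fittingIdeal (Polynomial K) (PlaneCurve.sylvesterCoker n μ f p q) 0 = ⊥ := by
    rw [hcoker, eq_bot_iff,
      PlaneCurve.minorIdeal_le_iff]
    intro r c
    have h1 := PlaneCurve.det_dvd_det_submatrix
      ((PlaneCurve.sylvesterPhi n μ f p q).map (PlaneCurve.dehom K)) r c
    have h2 := (PlaneCurve.dehom K).map_det (PlaneCurve.sylvesterPhi n μ f p q)
    rw [(hpq.minorIdeal_sylvesterPhi hf hn0 hμ).1, map_zero] at h2
    have h3 : ((PlaneCurve.sylvesterPhi n μ f p q).map (PlaneCurve.dehom K)).det = 0 := h2.symm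
    rw [h3] at h1
    exact zero_dvd_iff.1 h1
  have hF1 : PlaneCurve.fittingIdeal (Polynomial K) (PlaneCurve.sylvesterCoker n μ f p q) 1 =
      Ideal.span {PlaneCurve.dehom K (PlaneCurve.Delta n μ f p q)} := by
    rw [hcoker,
      ← hpq.minorIdeal_map_eq_span hf hn0 hμ, show μ + (n - μ) - 1 = n - 1 by omega]
  refine ⟨PlaneCurve.diag_mul_divDiag
      (PlaneCurve.diag_dvd_phiForm hpq.homogeneous_left hpq.sum_mul_left),
    PlaneCurve.diag_mul_divDiag
      (PlaneCurve.diag_dvd_phiForm hpq.homogeneous_right hpq.sum_mul_right),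
    ⟨_, pow_ne_zero _ (neg_ne_zero.2 one_ne_zero), hpq.aeval_SRes hμ⟩, hF0, hF1, ⟨?_, ?_⟩, ?_, ?_⟩
  · rw [Set.mem_ofPred_eq, hF1, Ne, Ideal.span_singleton_eq_bot]
    exact hpq.dehom_Delta_ne_zero hf hn
  · intro r hr
    by_contra hlt
    obtain rfl : r = 0 := by omega
    exact hr hF0
  · intro l hl
    -- Since `n - l < μ`, the relevant ideal of minors contains the ideal of minors of size `μ`,
    -- which is the unit ideal.
    rw [hcoker, eq_top_iff,
      ← hpq.minorIdeal_map_eq_top hf hn0]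
    exact PlaneCurve.minorIdeal_antitone _ (by omega)
  · intro d hd
    refine ⟨fun k hk hkn => PlaneCurve.exists_C_of_isUnit (hd.isUnit hpq hf hn0 hk hkn), ?_⟩
    obtain ⟨u, hu⟩ := (hd.associated_Delta hpq hf hn hμ).symm
    obtain ⟨γ, hγ, hγu⟩ := PlaneCurve.exists_C_of_isUnit u.isUnit
    exact ⟨γ, hγ, by rw [← hu, hγu, mul_comm]⟩
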